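/- Let $\mathbb F$ be one of $\mathbb R,\mathbb C,\mathbb H$, with real dimension $d=1,2,4$ respectively. For an integer $q\ge 1$ let $H_q$ be the real vector space of Hermitian $q\times q$ matrices over $\mathbb F$, with scalar product $\langle x,y\rangle=\operatorname{tr}(xy)$ and the corresponding Lebesgue measure $dy$, and let $n(q)=\dim_{\mathbb R}H_q=q+\frac d2 q(q-1)$. Let $\Pi_q\subset H_q$ be the cone of positive semidefinite matrices, let $\Delta(y)$ be the determinant of $y\in\Pi_q$ (the product of its $q$ eigenvalues, counted with multiplicity), and let $\Pi_q^I=\{y\in\Pi_q:\ I_q-y\in\Pi_q\}$. For real $\mu,\nu>d(q-1)/2$ the matrix beta distribution $\beta_{q;\mu,\nu}$ is the probability measure on $\Pi_q^I$ given by $$d\beta_{q;\mu,\nu}(y)=\frac1{B_q(\mu,\nu)}\,\Delta(y)^{\mu-n(q)/q}\,\Delta(I_q-y)^{\nu-n(q)/q}\,dy,\qquad B_q(\mu,\nu)=\int_{\Pi_q^I}\Delta(y)^{\mu-n(q)/q}\,\Delta(I_q-y)^{\nu-n(q)/q}\,dy .$$ **Proposition 6.6.** For integers $\tilde p\ge q\ge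 1$ let $$P_{\tilde p,q}:\Pi_{\tilde p}^I\to\Pi_q^I,\qquad r=\begin{pmatrix} y&*\\ *&*\end{pmatrix}\longmapsto y,$$ be the projection onto the upper left $q\times q$ block. Then for all real $\mu,\nu>d(\tilde p-1)/2$, the measure $\beta_{q;\mu,\nu}$ is the push-forward of the measure $\beta_{\tilde p;\mu,\nu}$ under $P_{\tilde p,q}$: $$P_{\tilde p,q}(\beta_{\tilde p;\mu,\nu})=\beta_{q;\mu,\nu}.$$ -/

import Mathlib

open MeasureTheory Matrix
open scoped Quaternion

/-! The Borel σ-algebra on the quaternions (its volume is then the Lebesgue measure of the Euclidean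
space `ℍ[ℝ]`), the entrywise σ-algebra on matrices, and compatibility of quaternionic conjugation
with real scalars. -/

noncomputable instance quaternionMeasurableSpace : MeasurableSpace ℍ[ℝ] := borel _

instance quaternionBorelSpace : BorelSpace ℍ[ℝ] := ⟨rfl⟩

instance quaternionStarModule : StarModule ℝ ℍ[ℝ] where
  star_smul r a := by rw [Quaternion.star_smul, star_trivial r]

instance matrixMeasurableSpace {m n α : Type*} [MeasurableSpace α] :
    MeasurableSpace (Matrix m n α) := MeasurableSpace.pi

noncomputable section

namespace MatrixBeta

/- In this section `𝔽` plays the role of one of the fields `ℝ`, `ℂ`, `ℍ[ℝ]`; the theorem is stated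
for exactly these three. -/

section Definitions

variable (𝔽 : Type*) [DivisionRing 𝔽] [StarRing 𝔽] [Algebra ℝ 𝔽]

/-- `d = dim_ℝ 𝔽`. -/
def realDim : ℕ := Module.finrank ℝ 𝔽

/-- `H_q`, the Hermitian `q × q` matrices over `𝔽`. -/
abbrev Herm (q : ℕ) : Type _ := selfAdjoint (Matrix (Fin q) (Fin q) 𝔽)

/-- `n = q + (d / 2) q (q - 1)`, the real dimension of `H_q`. -/
def hermDim (q : ℕ) : ℝ := q + (realDim 𝔽 : ℝ) / 2 * q * (q - 1)

/-- The cone `Π_q` of positive semidefinite Hermitian matrices: `v* x v` is a nonnegative real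
number for every column vector `v`. -/
def cone (q : ℕ) : Set (Herm 𝔽 q) :=
  {x | ∀ v : Fin q → 𝔽, ∃ r : ℝ, 0 ≤ r ∧
    star v ⬝ᵥ ((x : Matrix (Fin q) (Fin q) 𝔽) *ᵥ v) = algebraMap ℝ 𝔽 r}

/-- `Π_q^I = {y ∈ Π_q : y ≤ I}`, where `x ≤ y` means `y - x ∈ Π_q`. -/
def coneInterval (q : ℕ) : Set (Herm 𝔽 q) :=
  {y | y ∈ cone 𝔽 q ∧ 1 - y ∈ cone 𝔽 q}

variable {𝔽}

/-- Left multiplication by a square matrix on the column space `𝔽^q`, as a real-linear map. -/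
def mulVecReal {q : ℕ} (x : Matrix (Fin q) (Fin q) 𝔽) : (Fin q → 𝔽) →ₗ[ℝ] (Fin q → 𝔽) where
  toFun v := x *ᵥ v
  map_add' := x.mulVec_add
  map_smul' r v := x.mulVec_smul r v

/-- The determinant `Δ` on the cone `Π_q`, that is, the product of the `q` eigenvalues of `x`.
As a real-linear map on `𝔽^q`, a positive semidefinite `x` has each of its eigenvalues with `d`
times its multiplicity, so that the real determinant of this map is `Δ(x)^d`.
See `coneDet_eq_prod_eigenvalues`. -/
def coneDet {q : ℕ} (x : Matrix (Fin q) (Fin q) 𝔽) : ℝ :=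
  LinearMap.det (mulVecReal x) ^ ((realDim 𝔽 : ℝ)⁻¹)

/-- The Hermitian matrix with real diagonal entries `c.1 i` and entries `c.2 (i, j)` above the
diagonal. -/
def hermOfCoords [StarModule ℝ 𝔽] {q : ℕ}
    (c : (Fin q → ℝ) × ({ij : Fin q × Fin q // ij.1 < ij.2} → 𝔽)) : Herm 𝔽 q :=
  ⟨Matrix.of fun i j =>
      if h : i < j then c.2 ⟨(i, j), h⟩
      else if h' : j < i then star (c.2 ⟨(j, i), h'⟩)
      else algebraMap ℝ 𝔽 (c.1 i), by
    rw [selfAdjoint.mem_iff, Matrix.star_eq_conjTranspose]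
    ext i j
    rw [Matrix.conjTranspose_apply, Matrix.of_apply, Matrix.of_apply]
    rcases lt_trichotomy i j with h | h | h
    · simp [h, h.not_gt]
    · subst h
      simp [← algebraMap_star_comm]
    · simp [h, h.not_gt]⟩

variable (𝔽)

/-- Lebesgue measure on `H_q` for the scalar product `⟨x, y⟩ = tr (x y)`: the product of the
Lebesgue measures in the diagonal and upper off-diagonal entries, where each of the `n - q` real
off-diagonal coordinates counts with a factor `√2`. -/
def lebesgue [StarModule ℝ 𝔽] [MeasureSpace 𝔽] (q : ℕ) : Measure (Herm 𝔽 q) :=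
  ENNReal.ofReal (2 ^ ((hermDim 𝔽 q - q) / 2)) • Measure.map hermOfCoords volume

/-- Lebesgue measure on `Π_q^I`. -/
def lebesgueI [StarModule ℝ 𝔽] [MeasureSpace 𝔽] (q : ℕ) : Measure (coneInterval 𝔽 q) :=
  (lebesgue 𝔽 q).comap Subtype.val

variable {𝔽}

/-- The unnormalized beta density `Δ(y)^(μ - n/q) Δ(I - y)^(ν - n/q)`. -/
def betaKernel {q : ℕ} (μ ν : ℝ) (y : coneInterval 𝔽 q) : ℝ :=
  coneDet (y : Herm 𝔽 q).1 ^ (μ - hermDim 𝔽 q / q) *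
    coneDet (1 - (y : Herm 𝔽 q)).1 ^ (ν - hermDim 𝔽 q / q)

variable (𝔽)

/-- The beta integral `B(μ, ν)`, the integral of `Δ(y)^(μ - n/q) Δ(I - y)^(ν - n/q)` over
`Π_q^I`. -/
def betaIntegral [StarModule ℝ 𝔽] [MeasureSpace 𝔽] (q : ℕ) (μ ν : ℝ) : ℝ :=
  ∫ y : coneInterval 𝔽 q, betaKernel μ ν y ∂(lebesgueI 𝔽 q)

/-- The beta distribution `β_{q;μ,ν}` on `Π_q^I`. -/
def beta [StarModule ℝ 𝔽] [MeasureSpace 𝔽] (q : ℕ) (μ ν : ℝ) : Measure (coneInterval 𝔽 q) :=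
  (lebesgueI 𝔽 q).withDensity fun y =>
    ENNReal.ofReal ((betaIntegral 𝔽 q μ ν)⁻¹ * betaKernel μ ν y)

/-- The upper left `q × q` block of a Hermitian `p × p` matrix. -/
def upperLeft {p q : ℕ} (h : q ≤ p) (x : Herm 𝔽 p) : Herm 𝔽 q :=
  ⟨x.1.submatrix (Fin.castLE h) (Fin.castLE h), by
    have hx : star x.1 = x.1 := x.2
    rw [selfAdjoint.mem_iff, Matrix.star_eq_conjTranspose, Matrix.conjTranspose_submatrix,
      ← Matrix.star_eq_conjTranspose, hx]⟩

variable {𝔽}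

/-- The upper left block of a positive semidefinite matrix is positive semidefinite. -/
theorem upperLeft_mem_cone {p q : ℕ} (h : q ≤ p) {x : Herm 𝔽 p} (hx : x ∈ cone 𝔽 p) :
    upperLeft 𝔽 h x ∈ cone 𝔽 q := by
  intro v
  have hinj : Function.Injective (Fin.castLE h) := Fin.castLE_injective h
  obtain ⟨r, hr, hrx⟩ := hx (Function.extend (Fin.castLE h) v 0)
  refine ⟨r, hr, hrx ▸ ?_⟩
  refine Fintype.sum_of_injective (Fin.castLE h) hinj _ _ (fun i hi => ?_) (fun i => ?_)
  · rw [Pi.star_apply, Function.extend_apply' _ _ _ hi]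
    simp
  · rw [Pi.star_apply, Pi.star_apply, hinj.extend_apply]
    congr 1
    refine Fintype.sum_of_injective (Fin.castLE h) hinj _ _ (fun j hj => ?_) (fun j => ?_)
    · simp only [Function.extend_apply' _ _ _ hj, Pi.zero_apply, mul_zero]
    · simp only [hinj.extend_apply]
      rfl

theorem one_sub_upperLeft {p q : ℕ} (h : q ≤ p) (x : Herm 𝔽 p) :
    1 - upperLeft 𝔽 h x = upperLeft 𝔽 h (1 - x) := by
  apply Subtype.ext
  simp only [upperLeft, AddSubgroupClass.coe_sub, selfAdjoint.val_one, Matrix.submatrix_sub,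
    Pi.sub_apply, Matrix.submatrix_one _ (Fin.castLE_injective h)]

variable (𝔽)

/-- The projection `Π_p^I → Π_q^I` onto the upper left `q × q` block. -/
def proj {p q : ℕ} (h : q ≤ p) (x : coneInterval 𝔽 p) : coneInterval 𝔽 q :=
  ⟨upperLeft 𝔽 h x.1, upperLeft_mem_cone h x.2.1, by
    rw [one_sub_upperLeft]
    exact upperLeft_mem_cone h x.2.2⟩

/-- `coneDet` is the product of the eigenvalues: if `x = u diag(l) u*` with `u` unitary and `l`
nonnegative, then `Δ(x)` is the product of the `l i`. -/
theorem coneDet_eq_prod_eigenvalues [Module.Finite ℝ 𝔽] {q : ℕ} (u : Matrix (Fin q) (Fin q) 𝔽)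
    (hu : u * uᴴ = 1) (l : Fin q → ℝ) (hl : ∀ i, 0 ≤ l i) :
    coneDet (u * Matrix.diagonal (fun i => algebraMap ℝ 𝔽 (l i)) * uᴴ) = ∏ i, l i := by
  have hmul : ∀ x y : Matrix (Fin q) (Fin q) 𝔽,
      LinearMap.det (mulVecReal (x * y)) =
        LinearMap.det (mulVecReal x) * LinearMap.det (mulVecReal y) := by
    intro x y
    rw [← LinearMap.det_comp]
    congr 1
    apply LinearMap.ext
    intro v
    simp [mulVecReal]
  have hone : LinearMap.det (mulVecReal (1 : Matrix (Fin q) (Fin q) 𝔽)) = 1 := by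
    rw [← LinearMap.det_id (A := ℝ) (M := Fin q → 𝔽)]
    congr 1
    apply LinearMap.ext
    intro v
    simp [mulVecReal]
  have hdiag : LinearMap.det
      (mulVecReal (Matrix.diagonal (fun i => algebraMap ℝ 𝔽 (l i)))) =
        ∏ i, l i ^ realDim 𝔽 := by
    have : mulVecReal (Matrix.diagonal (fun i => algebraMap ℝ 𝔽 (l i))) =
        LinearMap.pi (fun i => (l i • (LinearMap.id : 𝔽 →ₗ[ℝ] 𝔽)).comp (LinearMap.proj i)) := by
      apply LinearMap.ext
      intro v
      ext i
      simp [mulVecReal, Matrix.mulVec_diagonal, Algebra.smul_def]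
    rw [this, LinearMap.det_pi]
    simp [realDim]
  have hd : realDim 𝔽 ≠ 0 := (Module.finrank_pos (R := ℝ) (M := 𝔽)).ne'
  rw [coneDet, hmul, hmul, mul_right_comm, ← hmul, hu, hone, one_mul, hdiag,
    Finset.prod_pow, Real.pow_rpow_inv_natCast (Finset.prod_nonneg fun i _ => hl i) hd]

end Definitions

end MatrixBeta

end

set_option linter.unusedSectionVars false

noncomputable section

namespace MatrixBeta

/-! Remove one row and column at a time. Write a Hermitian matrix of size N+1 as a block `y`, a last
column `v` and a real corner `s`; Lebesgue measure is a constant times the product of those in `y`,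
`v`, `s`. For invertible `y`, the Schur complement gives Δ(x) = Δ(y)(s - v*y⁻¹v), and likewise for 1
- x. Hence x lies in the cone interval iff y does and v*y⁻¹v ≤ s ≤ 1 - v*(1-y)⁻¹v. Integrating
Δ(x)^α Δ(1-x)^β over `s` is a scalar beta integral and leaves a multiple of (1 - v*(y⁻¹ +
(1-y)⁻¹)v)^(α+β+1), cut off at zero (`lintegral_kernel_bordered`).

Since y⁻¹ + (1-y)⁻¹ = y⁻¹(1-y)⁻¹, a linear change of variables in `v` produces (Δ(y)Δ(1-y))^(d/2).
So each step raises both exponents by d/2 at the cost of a finite nonzero constant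
(`exists_lintegral_kernel_bordered`).

Iterating from p down to q raises the exponents by d(p-q)/2, which is n(p)/p - n(q)/q: exactly the
change between the two beta densities (`exists_lintegral_upperLeft_mul_kernel`). The constants never
need to be computed, as they cancel on normalizing. The same reduction down to size 0 shows that the
beta integrals are finite and nonzero.

Determinants are those of real-linear maps throughout, which treats the quaternions on the same
footing. -/

/-- The self-adjoint elements are the real scalars, and `star a * a` is a nonnegative scalar. -/
class IsRealHermitian (𝔽 : Type*) [DivisionRing 𝔽] [StarRing 𝔽] [Algebra ℝ 𝔽] : Prop where
  exists_algebraMap_eq : ∀ a : 𝔽, star a = a → ∃ r : ℝ, algebraMap ℝ 𝔽 r = a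
  exists_star_mul_self : ∀ a : 𝔽, ∃ r : ℝ, 0 ≤ r ∧ star a * a = algebraMap ℝ 𝔽 r

/-! ### Hermitian forms over the scalars, read as real quadratic forms. -/

section Forms

variable {𝔽 : Type*} [DivisionRing 𝔽] [StarRing 𝔽] [Algebra ℝ 𝔽] [StarModule ℝ 𝔽]
  [IsRealHermitian 𝔽]

theorem star_algebraMap (r : ℝ) : star (algebraMap ℝ 𝔽 r) = algebraMap ℝ 𝔽 r := by
  rw [← algebraMap_star_comm, star_trivial]

theorem exists_algebraMap_eq_half_add_star (a : 𝔽) :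
    ∃ r : ℝ, algebraMap ℝ 𝔽 r = (2⁻¹ : ℝ) • (a + star a) :=
  IsRealHermitian.exists_algebraMap_eq _ (by simp [add_comm])

/-- The real part `(a + star a) / 2`, as a function. -/
def reFun (a : 𝔽) : ℝ := (exists_algebraMap_eq_half_add_star a).choose

theorem algebraMap_reFun (a : 𝔽) : algebraMap ℝ 𝔽 (reFun a) = (2⁻¹ : ℝ) • (a + star a) :=
  (exists_algebraMap_eq_half_add_star a).choose_spec

/-- The real part `(a + star a) / 2`. -/
def re : 𝔽 →ₗ[ℝ] ℝ where
  toFun := reFun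
  map_add' a b := by
    apply (algebraMap ℝ 𝔽).injective
    simp only [map_add, algebraMap_reFun, star_add, smul_add]
    abel
  map_smul' r a := by
    apply (algebraMap ℝ 𝔽).injective
    rw [RingHom.id_apply, smul_eq_mul, map_mul, ← Algebra.smul_def]
    simp only [algebraMap_reFun, star_smul, star_trivial]
    rw [← smul_add, smul_comm]

theorem algebraMap_re (a : 𝔽) : algebraMap ℝ 𝔽 (re a) = (2⁻¹ : ℝ) • (a + star a) :=
  algebraMap_reFun a

theorem re_star (a : 𝔽) : re (star a) = re a := by
  apply (algebraMap ℝ 𝔽).injective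
  rw [algebraMap_re, algebraMap_re, star_star, add_comm]

theorem algebraMap_re_of_star_eq {a : 𝔽} (h : star a = a) : algebraMap ℝ 𝔽 (re a) = a := by
  rw [algebraMap_re, h, ← two_smul ℝ a, smul_smul]; norm_num

theorem re_algebraMap (r : ℝ) : re (algebraMap ℝ 𝔽 r) = r :=
  (algebraMap ℝ 𝔽).injective (algebraMap_re_of_star_eq (star_algebraMap r))

/-- The squared modulus of a scalar. -/
def sqAbs (a : 𝔽) : ℝ := re (star a * a)

theorem star_mul_self_eq (a : 𝔽) : star a * a = algebraMap ℝ 𝔽 (sqAbs a) :=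
  (algebraMap_re_of_star_eq (by simp)).symm

theorem sqAbs_nonneg (a : 𝔽) : 0 ≤ sqAbs a := by
  obtain ⟨r, hr, h⟩ := IsRealHermitian.exists_star_mul_self a
  rwa [sqAbs, h, re_algebraMap]

theorem sqAbs_pos {a : 𝔽} (ha : a ≠ 0) : 0 < sqAbs a := by
  refine (sqAbs_nonneg a).lt_of_ne fun h => ?_
  have := star_mul_self_eq a
  rw [← h, map_zero] at this
  simp [ha] at this

variable {q : ℕ}

/-- The real bilinear form `re (v* x w)` of a matrix. -/
def form (x : Matrix (Fin q) (Fin q) 𝔽) (v w : Fin q → 𝔽) : ℝ := re (star v ⬝ᵥ (x *ᵥ w))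

theorem star_form_arg (x : Herm 𝔽 q) (v w : Fin q → 𝔽) :
    star (star v ⬝ᵥ (x.1 *ᵥ w)) = star w ⬝ᵥ (x.1 *ᵥ v) := by
  have hx : x.1ᴴ = x.1 := x.2
  rw [star_dotProduct, star_star, star_mulVec, hx, ← dotProduct_mulVec]

theorem form_comm (x : Herm 𝔽 q) (v w : Fin q → 𝔽) : form x.1 v w = form x.1 w v := by
  rw [form, form, ← star_form_arg, re_star]

theorem algebraMap_form_self (x : Herm 𝔽 q) (v : Fin q → 𝔽) :
    algebraMap ℝ 𝔽 (form x.1 v v) = star v ⬝ᵥ (x.1 *ᵥ v) :=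
  algebraMap_re_of_star_eq (star_form_arg x v v)

theorem mem_cone_iff (x : Herm 𝔽 q) : x ∈ cone 𝔽 q ↔ ∀ v, 0 ≤ form x.1 v v := by
  refine forall_congr' fun v => ⟨?_, fun h => ⟨_, h, (algebraMap_form_self x v).symm⟩⟩
  rintro ⟨r, hr, h⟩
  rwa [form, h, re_algebraMap]

theorem form_one_self_pos {v : Fin q → 𝔽} (hv : v ≠ 0) : 0 < form 1 v v := by
  obtain ⟨i, hi⟩ := Function.ne_iff.1 hv
  rw [form, one_mulVec, dotProduct, map_sum]
  exact Finset.sum_pos' (fun j _ => sqAbs_nonneg (v j)) ⟨i, Finset.mem_univ i, sqAbs_pos hi⟩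

theorem form_add_left (x : Matrix (Fin q) (Fin q) 𝔽) (u v w : Fin q → 𝔽) :
    form x (u + v) w = form x u w + form x v w := by
  simp [form, add_dotProduct]

theorem form_add_right (x : Matrix (Fin q) (Fin q) 𝔽) (u v w : Fin q → 𝔽) :
    form x u (v + w) = form x u v + form x u w := by
  simp [form, mulVec_add]

theorem form_sum_sum {ι : Type*} [Fintype ι] (x : Matrix (Fin q) (Fin q) 𝔽) (c d : ι → ℝ)
    (b : ι → Fin q → 𝔽) :
    form x (∑ i, c i • b i) (∑ j, d j • b j) = ∑ i, ∑ j, c i * (d j * form x (b i) (b j)) := by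
  simp only [form, sum_dotProduct, mulVec_sum, dotProduct_sum, smul_dotProduct, mulVec_smul,
    star_sum, star_smul, star_trivial, dotProduct_smul, map_sum, map_smul, smul_eq_mul,
    Finset.mul_sum]
  rw [Finset.sum_comm]
  exact Finset.sum_congr rfl fun i _ => Finset.sum_congr rfl fun j _ => by ring

theorem form_add_mat (x y : Matrix (Fin q) (Fin q) 𝔽) (v w : Fin q → 𝔽) :
    form (x + y) v w = form x v w + form y v w := by
  simp [form, add_mulVec]

section Gram

variable {ι : Type*} (b : Module.Basis ι ℝ (Fin q → 𝔽))

/-- The real Gram matrix of `form x` in a basis. -/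
def gram (x : Matrix (Fin q) (Fin q) 𝔽) : Matrix ι ι ℝ := .of fun i j => form x (b i) (b j)

theorem form_eq_gram [Fintype ι] (x : Matrix (Fin q) (Fin q) 𝔽) (v : Fin q → 𝔽) :
    form x v v = b.equivFun v ⬝ᵥ (gram b x *ᵥ b.equivFun v) := by
  conv_lhs => rw [← b.sum_equivFun v, form_sum_sum]
  simp [dotProduct, mulVec, gram, Finset.mul_sum, mul_comm]

theorem gram_eq_mul [Fintype ι] [DecidableEq ι] (x : Matrix (Fin q) (Fin q) 𝔽) :
    gram b x = gram b 1 * LinearMap.toMatrix b b (mulVecReal x) := by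
  ext i j
  rw [Matrix.mul_apply, gram, of_apply, form]
  have : x *ᵥ b j = ∑ k, LinearMap.toMatrix b b (mulVecReal x) k j • b k := by
    simp only [LinearMap.toMatrix_apply, Module.Basis.sum_repr]
    rfl
  rw [this, dotProduct_sum, map_sum]
  refine Finset.sum_congr rfl fun k _ => ?_
  simp [gram, form, mul_comm]

/-- Transfers sign and nondegeneracy questions about `realDet` to real symmetric matrices; the
factor `(gram b 1).det` is positive. -/
theorem det_gram [Fintype ι] [DecidableEq ι] (x : Matrix (Fin q) (Fin q) 𝔽) :
    (gram b x).det = (gram b 1).det * LinearMap.det (mulVecReal x) := by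
  rw [gram_eq_mul, det_mul, LinearMap.det_toMatrix]

theorem isHermitian_gram (x : Herm 𝔽 q) : (gram b x.1).IsHermitian := by
  ext i j
  simp [gram, form_comm x (b j)]

theorem posSemidef_gram [Fintype ι] [DecidableEq ι] {x : Herm 𝔽 q}
    (hx : x ∈ cone 𝔽 q) : (gram b x.1).PosSemidef := by
  refine .of_dotProduct_mulVec_nonneg (isHermitian_gram b x) fun c => ?_
  rw [star_trivial, ← b.equivFun.apply_symm_apply c, ← form_eq_gram]
  exact (mem_cone_iff x).1 hx _

theorem posDef_gram [Fintype ι] [DecidableEq ι] {x : Herm 𝔽 q}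
    (hx : ∀ v, v ≠ 0 → 0 < form x.1 v v) : (gram b x.1).PosDef := by
  refine .of_dotProduct_mulVec_pos (isHermitian_gram b x) fun c hc => ?_
  rw [star_trivial, ← b.equivFun.apply_symm_apply c, ← form_eq_gram]
  exact hx _ (b.equivFun.symm.map_ne_zero_iff.2 hc)

theorem det_gram_one_pos [Fintype ι] [DecidableEq ι] :
    0 < (gram b (1 : Matrix (Fin q) (Fin q) 𝔽)).det :=
  (posDef_gram b (x := 1) fun _ hv => form_one_self_pos hv).det_pos

end Gram

variable [Module.Finite ℝ 𝔽]

/-- The determinant of `x` as a real-linear map of the column space. -/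
abbrev realDet (x : Matrix (Fin q) (Fin q) 𝔽) : ℝ := LinearMap.det (mulVecReal x)

theorem realDet_nonneg {x : Herm 𝔽 q} (hx : x ∈ cone 𝔽 q) : 0 ≤ realDet x.1 := by
  let b := Module.finBasis ℝ (Fin q → 𝔽)
  have h := (posSemidef_gram b hx).det_nonneg
  rw [det_gram] at h
  exact nonneg_of_mul_nonneg_right h (det_gram_one_pos b)

theorem form_pos_of_realDet_ne_zero {x : Herm 𝔽 q} (hx : x ∈ cone 𝔽 q) (hd : realDet x.1 ≠ 0)
    {v : Fin q → 𝔽} (hv : v ≠ 0) : 0 < form x.1 v v := by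
  let b := Module.finBasis ℝ (Fin q → 𝔽)
  have h : (gram b x.1).PosDef := (posSemidef_gram b hx).posDef_iff_det_ne_zero.2 (by
    rw [det_gram]
    exact mul_ne_zero (det_gram_one_pos b).ne' hd)
  rw [form_eq_gram b]
  simpa using h.dotProduct_mulVec_pos (x := b.equivFun v) (by simpa using hv)

theorem realDet_mul (x y : Matrix (Fin q) (Fin q) 𝔽) :
    realDet (x * y) = realDet x * realDet y := by
  rw [realDet, realDet, realDet, ← LinearMap.det_comp]
  congr 1
  refine LinearMap.ext fun v => ?_
  simp [mulVecReal]

theorem realDet_one : realDet (1 : Matrix (Fin q) (Fin q) 𝔽) = 1 := by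
  rw [realDet, ← LinearMap.det_id (A := ℝ) (M := Fin q → 𝔽)]
  congr 1
  refine LinearMap.ext fun v => ?_
  simp [mulVecReal]

/-- The columns of a right inverse are preimages of the unit vectors. Its adjoint is a left inverse
because `x` is Hermitian, so the two coincide and the inverse is Hermitian. -/
theorem exists_inverse {x : Herm 𝔽 q} (hd : realDet x.1 ≠ 0) :
    ∃ z : Herm 𝔽 q, x.1 * z.1 = 1 ∧ z.1 * x.1 = 1 := by
  have hsurj : Function.Surjective (mulVecReal x.1) := by
    have := LinearMap.isUnit_iff_isUnit_det (mulVecReal x.1) |>.2 (isUnit_iff_ne_zero.2 hd)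
    exact ((Module.End.isUnit_iff _).1 this).2
  choose z hz using fun j => hsurj (Pi.single j 1)
  let Z : Matrix (Fin q) (Fin q) 𝔽 := (Matrix.of z)ᵀ
  have h1 : x.1 * Z = 1 := by
    ext i j
    have := congrFun (hz j) i
    rw [Matrix.one_apply, ← Pi.single_apply, ← this]
    rfl
  have hx : x.1ᴴ = x.1 := x.2
  have h2 : Zᴴ * x.1 = 1 := by
    simpa [hx] using congrArg conjTranspose h1
  have h3 : Zᴴ = Z := by
    rw [← mul_one Zᴴ, ← h1, ← mul_assoc, h2, one_mul]
  exact ⟨⟨Z, h3⟩, h1, by rwa [h3] at h2⟩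

end Forms

/-! ### Bordered matrices and Schur complements. -/

section Bordered

variable {𝔽 : Type*} [DivisionRing 𝔽] [StarRing 𝔽] [Algebra ℝ 𝔽] [StarModule ℝ 𝔽]
  {N : ℕ}

/-- The Hermitian matrix with upper left block `y`, last column `v` and lower right entry `s`. -/
def bordered (y : Herm 𝔽 N) (v : Fin N → 𝔽) (s : ℝ) : Herm 𝔽 (N + 1) :=
  ⟨Matrix.of (Fin.snoc (α := fun _ => Fin (N + 1) → 𝔽)
      (fun i => Fin.snoc (α := fun _ => 𝔽) (y.1 i) (v i))
      (Fin.snoc (α := fun _ => 𝔽) (star v) (algebraMap ℝ 𝔽 s))), by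
    rw [selfAdjoint.mem_iff, star_eq_conjTranspose]
    ext i j
    have hy : ∀ i j, star (y.1 j i) = y.1 i j := fun i j => congrFun (congrFun y.2 i) j
    induction i using Fin.lastCases <;> induction j using Fin.lastCases <;>
      simp [hy, ← algebraMap_star_comm]⟩

@[simp] theorem bordered_castSucc_castSucc (y : Herm 𝔽 N) (v : Fin N → 𝔽) (s : ℝ) (i j : Fin N) :
    (bordered y v s).1 i.castSucc j.castSucc = y.1 i j := by simp [bordered]

@[simp] theorem bordered_castSucc_last (y : Herm 𝔽 N) (v : Fin N → 𝔽) (s : ℝ) (i : Fin N) :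
    (bordered y v s).1 i.castSucc (Fin.last N) = v i := by simp [bordered]

@[simp] theorem bordered_last_castSucc (y : Herm 𝔽 N) (v : Fin N → 𝔽) (s : ℝ) (j : Fin N) :
    (bordered y v s).1 (Fin.last N) j.castSucc = star (v j) := by simp [bordered]

@[simp] theorem bordered_last_last (y : Herm 𝔽 N) (v : Fin N → 𝔽) (s : ℝ) :
    (bordered y v s).1 (Fin.last N) (Fin.last N) = algebraMap ℝ 𝔽 s := by simp [bordered]

theorem upperLeft_bordered (y : Herm 𝔽 N) (v : Fin N → 𝔽) (s : ℝ) :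
    upperLeft 𝔽 N.le_succ (bordered y v s) = y := by
  ext i j
  exact bordered_castSucc_castSucc y v s i j

theorem one_sub_bordered (y : Herm 𝔽 N) (v : Fin N → 𝔽) (s : ℝ) :
    1 - bordered y v s = bordered (1 - y) (-v) (1 - s) := by
  ext i j
  induction i using Fin.lastCases <;> induction j using Fin.lastCases <;>
    simp [Matrix.one_apply, Fin.castSucc_ne_last, (Fin.castSucc_ne_last _).symm]

theorem bordered_mulVec_snoc (y : Herm 𝔽 N) (v : Fin N → 𝔽) (s : ℝ) (w : Fin N → 𝔽) (t : 𝔽) :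
    (bordered y v s).1 *ᵥ (Fin.snoc (α := fun _ => 𝔽) w t) =
      Fin.snoc (α := fun _ => 𝔽) (y.1 *ᵥ w + fun i => v i * t) (star v ⬝ᵥ w + s • t) := by
  ext i
  induction i using Fin.lastCases <;>
    simp [mulVec, dotProduct, Fin.sum_univ_castSucc, Algebra.smul_def]

theorem star_snoc_dotProduct_snoc (w w' : Fin N → 𝔽) (t t' : 𝔽) :
    star (Fin.snoc (α := fun _ => 𝔽) w t : Fin (N + 1) → 𝔽) ⬝ᵥ Fin.snoc (α := fun _ => 𝔽) w' t' =
      star w ⬝ᵥ w' + star t * t' := by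
  simp [dotProduct, Fin.sum_univ_castSucc]

variable [IsRealHermitian 𝔽]

theorem dotProduct_col_mul (a v : Fin N → 𝔽) (t : 𝔽) : a ⬝ᵥ (fun i => v i * t) = (a ⬝ᵥ v) * t := by
  simp [dotProduct, Finset.sum_mul, mul_assoc]

theorem star_col_mul_dotProduct (u a : Fin N → 𝔽) (t : 𝔽) :
    star (fun i => u i * t) ⬝ᵥ a = star t * (star u ⬝ᵥ a) := by
  simp [dotProduct, Finset.mul_sum, mul_assoc]

theorem star_mulVec_dotProduct (y : Herm 𝔽 N) (u w : Fin N → 𝔽) :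
    star (y.1 *ᵥ u) ⬝ᵥ w = star u ⬝ᵥ (y.1 *ᵥ w) := by
  have hy : y.1ᴴ = y.1 := y.2
  rw [star_mulVec, hy, dotProduct_mulVec]

/-- Completing the square. Writing the last column as `y u` replaces v*y⁻¹v by `form y u u`, so no
inverse is needed. -/
theorem form_bordered (y : Herm 𝔽 N) (u : Fin N → 𝔽) (s : ℝ) (w : Fin N → 𝔽) (t : 𝔽) :
    form (bordered y (y.1 *ᵥ u) s).1 (Fin.snoc (α := fun _ => 𝔽) w t)
        (Fin.snoc (α := fun _ => 𝔽) w t) =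
      form y.1 (w + fun i => u i * t) (w + fun i => u i * t) +
        (s - form y.1 u u) * sqAbs t := by
  have hu : y.1 *ᵥ (fun i => u i * t) = fun i => (y.1 *ᵥ u) i * t := by
    ext i
    exact dotProduct_col_mul _ _ _
  have h1 : form y.1 (fun i => u i * t) (fun i => u i * t) = form y.1 u u * sqAbs t := by
    have h : star (fun i => u i * t) ⬝ᵥ (y.1 *ᵥ fun i => u i * t) =
        form y.1 u u • (star t * t) := by
      rw [hu, dotProduct_col_mul, star_col_mul_dotProduct, ← algebraMap_form_self,
        ← Algebra.commutes, mul_assoc, Algebra.smul_def]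
    rw [form, h, map_smul]; rfl
  have h2 : re (star t * (star (y.1 *ᵥ u) ⬝ᵥ w)) = form y.1 (fun i => u i * t) w := by
    rw [form, star_mulVec_dotProduct, star_col_mul_dotProduct]
  have h3 : re (star w ⬝ᵥ y.1 *ᵥ fun i => u i * t) = re (star t * (star (y.1 *ᵥ u) ⬝ᵥ w)) := by
    rw [h2, ← form_comm]; rfl
  rw [form_add_left, form_add_right, form_add_right, h1, ← h2, form,
    bordered_mulVec_snoc, star_snoc_dotProduct_snoc, ← hu]
  simp only [dotProduct_add, mul_add, map_add, mul_smul_comm, map_smul, form, sqAbs,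
    smul_eq_mul, h3]
  ring

theorem bordered_mem_cone_iff {y : Herm 𝔽 N} (hy : y ∈ cone 𝔽 N) (u : Fin N → 𝔽) (s : ℝ) :
    bordered y (y.1 *ᵥ u) s ∈ cone 𝔽 (N + 1) ↔ form y.1 u u ≤ s := by
  rw [mem_cone_iff] at hy ⊢
  constructor
  · intro h
    -- The vector (-u, 1) kills the completed square and isolates the Schur complement.
    have h0 := h (Fin.snoc (α := fun _ => 𝔽) (-u) 1)
    have hu : (-u + fun i => u i * 1) = 0 := by ext i; simp
    have h1 : sqAbs (1 : 𝔽) = 1 := by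
      rw [sqAbs, star_one, mul_one, ← map_one (algebraMap ℝ 𝔽), re_algebraMap]
    rw [form_bordered, hu, h1] at h0
    simpa [form] using h0
  · intro h v
    rw [← Fin.snoc_init_self v, form_bordered]
    exact add_nonneg (hy _) (mul_nonneg (sub_nonneg.2 h) (sqAbs_nonneg _))

variable [Module.Finite ℝ 𝔽]

/-- Splitting off the last coordinate, as a real-linear equivalence. -/
def snocEquiv (𝔽 : Type*) [DivisionRing 𝔽] [Algebra ℝ 𝔽] (N : ℕ) :
    ((Fin N → 𝔽) × 𝔽) ≃ₗ[ℝ] (Fin (N + 1) → 𝔽) where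
  toFun p := Fin.snoc (α := fun _ => 𝔽) p.1 p.2
  invFun v := (Fin.init v, v (Fin.last N))
  map_add' p p' := by
    ext i
    induction i using Fin.lastCases <;> simp
  map_smul' r p := by
    ext i
    induction i using Fin.lastCases <;> simp
  left_inv p := by simp
  right_inv v := by simp

/-- Doubling the first factor conjugates the shear by `g` into the shear by `2g`, which is its
square. Thus det² = det, and the determinant is nonzero because the shear by `-g` is an inverse. -/
theorem det_shear_left {V W : Type*} [AddCommGroup V] [Module ℝ V] [AddCommGroup W] [Module ℝ W]
    [Module.Finite ℝ V] [Module.Finite ℝ W] (g : W →ₗ[ℝ] V) :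
    LinearMap.det (LinearMap.id + (LinearMap.inl ℝ V W) ∘ₗ g ∘ₗ (LinearMap.snd ℝ V W)) = 1 := by
  set S : (W →ₗ[ℝ] V) → (V × W →ₗ[ℝ] V × W) := fun g =>
    LinearMap.id + (LinearMap.inl ℝ V W) ∘ₗ g ∘ₗ (LinearMap.snd ℝ V W) with hS
  have hadd : ∀ g g', S (g + g') = S g ∘ₗ S g' := by
    intro g g'
    ext <;> simp [hS, add_comm]
  have hzero : S 0 = LinearMap.id := by ext <;> simp [hS]
  have hconj : S g ∘ₗ S g =
      (LinearEquiv.prodCongr (LinearEquiv.smulOfNeZero ℝ V (2 : ℝ) two_ne_zero)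
        (LinearEquiv.refl ℝ W) : V × W →ₗ[ℝ] V × W) ∘ₗ S g ∘ₗ
      ((LinearEquiv.prodCongr (LinearEquiv.smulOfNeZero ℝ V (2 : ℝ) two_ne_zero)
        (LinearEquiv.refl ℝ W)).symm : V × W →ₗ[ℝ] V × W) := by
    rw [← hadd]
    ext <;> simp [hS, two_smul]
    rw [← two_smul ℝ, Units.smul_def, smul_smul]
    simp
  have h1 := congrArg LinearMap.det hconj
  rw [LinearMap.det_comp, LinearMap.det_conj] at h1
  have h2 : LinearMap.det (S g) * LinearMap.det (S (-g)) = 1 := by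
    rw [← LinearMap.det_comp, ← hadd, add_neg_cancel, hzero, LinearMap.det_id]
  exact mul_left_cancel₀ (left_ne_zero_of_mul_eq_one h2) (h1.trans (mul_one _).symm)

theorem det_shear_right {V W : Type*} [AddCommGroup V] [Module ℝ V] [AddCommGroup W] [Module ℝ W]
    [Module.Finite ℝ V] [Module.Finite ℝ W] (g : V →ₗ[ℝ] W) :
    LinearMap.det (LinearMap.id + (LinearMap.inr ℝ V W) ∘ₗ g ∘ₗ (LinearMap.fst ℝ V W)) = 1 := by
  rw [← det_shear_left g, ← LinearMap.det_conj _ (LinearEquiv.prodComm ℝ V W)]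
  congr 1

/-- Block LDL* factorization: two shears around a block diagonal map. The Schur complement is a real
scalar acting on the d-dimensional last coordinate, hence the power d. -/
theorem realDet_bordered (y : Herm 𝔽 N) (u : Fin N → 𝔽) (s : ℝ) :
    realDet (bordered y (y.1 *ᵥ u) s).1 = realDet y.1 * (s - form y.1 u u) ^ realDim 𝔽 := by
  let g₁ : 𝔽 →ₗ[ℝ] (Fin N → 𝔽) :=
    { toFun := fun t i => u i * t
      map_add' := fun a b => by ext i; simp [mul_add]
      map_smul' := fun r a => by ext i; simp }
  let g₂ : (Fin N → 𝔽) →ₗ[ℝ] 𝔽 :=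
    { toFun := fun a => star u ⬝ᵥ a
      map_add' := fun a b => by simp [dotProduct_add]
      map_smul' := fun r a => by simp [dotProduct_smul] }
  let D : ((Fin N → 𝔽) × 𝔽) →ₗ[ℝ] ((Fin N → 𝔽) × 𝔽) :=
    (mulVecReal y.1).prodMap ((s - form y.1 u u) • LinearMap.id)
  have h : mulVecReal (bordered y (y.1 *ᵥ u) s).1 = (snocEquiv 𝔽 N : _ →ₗ[ℝ] _) ∘ₗ
      ((LinearMap.id + (LinearMap.inr ℝ _ _) ∘ₗ g₂ ∘ₗ (LinearMap.fst ℝ _ _)) ∘ₗ D ∘ₗ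
        (LinearMap.id + (LinearMap.inl ℝ _ _) ∘ₗ g₁ ∘ₗ (LinearMap.snd ℝ _ _))) ∘ₗ
      ((snocEquiv 𝔽 N).symm : _ →ₗ[ℝ] _) := by
    refine LinearMap.ext fun v => ?_
    obtain ⟨⟨w, t⟩, rfl⟩ := (snocEquiv 𝔽 N).surjective v
    have hu : y.1 *ᵥ (fun i => u i * t) = fun i => (y.1 *ᵥ u) i * t := by
      ext i
      exact dotProduct_col_mul _ _ _
    have h1 : mulVecReal (bordered y (y.1 *ᵥ u) s).1 (snocEquiv 𝔽 N (w, t)) =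
      snocEquiv 𝔽 N (_, _) := bordered_mulVec_snoc y (y.1 *ᵥ u) s w t
    have h2 : star u ⬝ᵥ (y.1 *ᵥ fun i => u i * t) = form y.1 u u • t := by
      rw [hu, dotProduct_col_mul, ← algebraMap_form_self, Algebra.smul_def]
    rw [h1]
    simp only [LinearMap.comp_apply, LinearEquiv.coe_coe, LinearEquiv.symm_apply_apply]
    congr 1
    simp only [D, g₁, g₂, mulVecReal, LinearMap.add_apply, LinearMap.id_apply,
      LinearMap.comp_apply, LinearMap.snd_apply, LinearMap.fst_apply, LinearMap.inl_apply,
      LinearMap.inr_apply, LinearMap.prodMap_apply, LinearMap.coe_mk, AddHom.coe_mk,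
      LinearMap.smul_apply, Prod.mk_add_mk, add_zero, mulVec_add,
      dotProduct_add, h2, ← hu, star_mulVec_dotProduct, sub_smul]
    congr 1
    abel
  rw [realDet, h, LinearMap.det_conj, LinearMap.det_comp, LinearMap.det_comp, det_shear_left,
    det_shear_right, LinearMap.det_prodMap, LinearMap.det_smul, LinearMap.det_id]
  simp [realDim]

theorem coneDet_bordered {y : Herm 𝔽 N} (hy : y ∈ cone 𝔽 N) (u : Fin N → 𝔽) {s : ℝ}
    (hs : form y.1 u u ≤ s) :
    coneDet (bordered y (y.1 *ᵥ u) s).1 = coneDet y.1 * (s - form y.1 u u) := by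
  have hd : realDim 𝔽 ≠ 0 := (Module.finrank_pos (R := ℝ) (M := 𝔽)).ne'
  have hs := sub_nonneg.2 hs
  change realDet _ ^ _ = realDet _ ^ _ * _
  rw [realDet_bordered, Real.mul_rpow (realDet_nonneg hy) (by positivity),
    Real.pow_rpow_inv_natCast hs hd]

theorem upperLeft_mem_cone_of_bordered {y : Herm 𝔽 N} {v : Fin N → 𝔽} {s : ℝ}
    (h : bordered y v s ∈ cone 𝔽 (N + 1)) : y ∈ cone 𝔽 N := by
  rw [← upperLeft_bordered y v s]
  exact upperLeft_mem_cone _ h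

end Bordered

/-! ### Lebesgue measure on Hermitian matrices and its disintegration along the last row and column.
-/

section Lebesgue

variable {𝔽 : Type*} [DivisionRing 𝔽] [StarRing 𝔽] [Algebra ℝ 𝔽] [StarModule ℝ 𝔽]
  [IsRealHermitian 𝔽] [Module.Finite ℝ 𝔽] [TopologicalSpace 𝔽] [IsTopologicalRing 𝔽]
  [ContinuousSMul ℝ 𝔽] [ContinuousStar 𝔽] [T2Space 𝔽] {N q : ℕ}

theorem continuous_re : Continuous (re : 𝔽 → ℝ) :=
  (re (𝔽 := 𝔽)).continuous_of_finiteDimensional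

theorem continuous_entry (i j : Fin q) : Continuous fun x : Herm 𝔽 q => x.1 i j :=
  (continuous_apply_apply i j).comp continuous_subtype_val

theorem continuous_mulVec (w : Fin q → 𝔽) : Continuous fun x : Herm 𝔽 q => x.1 *ᵥ w :=
  continuous_subtype_val.matrix_mulVec continuous_const

theorem continuous_form (v w : Fin q → 𝔽) : Continuous fun x : Herm 𝔽 q => form x.1 v w := by
  exact continuous_re.comp (continuous_const.dotProduct (continuous_mulVec w))

theorem continuous_realDet : Continuous fun x : Herm 𝔽 q => realDet x.1 := by
  let b := Module.finBasis ℝ (Fin q → 𝔽)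
  simp_rw [realDet, ← LinearMap.det_toMatrix b]
  refine Continuous.matrix_det (continuous_matrix fun i j => ?_)
  simp only [LinearMap.toMatrix_apply]
  refine (LinearMap.continuous_of_finiteDimensional (b.coord i)).comp ?_
  exact continuous_mulVec (b j)

theorem isClosed_cone : IsClosed (cone 𝔽 q) := by
  have : cone 𝔽 q = ⋂ v, {x | 0 ≤ form x.1 v v} := by
    ext x
    simp [mem_cone_iff]
  rw [this]
  exact isClosed_iInter fun v => isClosed_le continuous_const (continuous_form v v)

theorem continuous_one_sub : Continuous fun x : Herm 𝔽 q => 1 - x :=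
  Continuous.subtype_mk (continuous_const.sub continuous_subtype_val) _

theorem isClosed_coneInterval : IsClosed (coneInterval 𝔽 q) :=
  isClosed_cone.inter (isClosed_cone.preimage continuous_one_sub)

theorem continuous_herm_iff {X : Type*} [TopologicalSpace X] {f : X → Herm 𝔽 q} :
    Continuous f ↔ ∀ i j, Continuous fun a => (f a).1 i j :=
  ⟨fun h i j => (continuous_entry i j).comp h,
    fun h => Continuous.subtype_mk (continuous_matrix h) _⟩

/-- The coordinates of a Hermitian matrix. -/
def coordsEquiv (𝔽 : Type*) [DivisionRing 𝔽] [StarRing 𝔽] [Algebra ℝ 𝔽] [StarModule ℝ 𝔽]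
    [IsRealHermitian 𝔽] (q : ℕ) :
    ((Fin q → ℝ) × ({ij : Fin q × Fin q // ij.1 < ij.2} → 𝔽)) ≃+ Herm 𝔽 q where
  toFun := hermOfCoords
  invFun x := (fun i => re (x.1 i i), fun ij => x.1 ij.1.1 ij.1.2)
  left_inv c := by
    refine Prod.ext (funext fun i => ?_) (funext fun ij => ?_)
    · simp [hermOfCoords, re_algebraMap]
    · simp [hermOfCoords, ij.2]
  right_inv x := by
    have hx : ∀ i j, star (x.1 j i) = x.1 i j := fun i j => congrFun (congrFun x.2 i) j
    ext i j
    rcases lt_trichotomy i j with h | rfl | h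
    · simp [hermOfCoords, h]
    · simp [hermOfCoords, algebraMap_re_of_star_eq (hx i i)]
    · simp [hermOfCoords, h, h.not_gt, hx]
  map_add' c c' := by
    ext i j
    rcases lt_trichotomy i j with h | rfl | h
    · simp [hermOfCoords, h]
    · simp [hermOfCoords]
    · simp [hermOfCoords, h, h.not_gt]

theorem continuous_coordsEquiv : Continuous (coordsEquiv 𝔽 q) := by
  refine continuous_herm_iff.2 fun i j => ?_
  have hr : Continuous (algebraMap ℝ 𝔽) := continuous_algebraMap ℝ 𝔽
  rcases lt_trichotomy i j with h | rfl | h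
  · simp only [coordsEquiv, hermOfCoords, AddEquiv.coe_mk, Equiv.coe_fn_mk, of_apply, h, dite_true]
    fun_prop
  · simp only [coordsEquiv, hermOfCoords, AddEquiv.coe_mk, Equiv.coe_fn_mk, of_apply,
      lt_irrefl, dite_false]
    fun_prop
  · simp only [coordsEquiv, hermOfCoords, AddEquiv.coe_mk, Equiv.coe_fn_mk, of_apply, h,
      h.not_gt, dite_true, dite_false]
    fun_prop

theorem continuous_coordsEquiv_symm : Continuous (coordsEquiv 𝔽 q).symm :=
  (continuous_pi fun i => continuous_re.comp (continuous_entry i i)).prodMk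
    (continuous_pi fun ij => continuous_entry ij.1.1 ij.1.2)

/-- Bordered matrices as an additive equivalence. -/
def borderedEquiv (𝔽 : Type*) [DivisionRing 𝔽] [StarRing 𝔽] [Algebra ℝ 𝔽] [StarModule ℝ 𝔽]
    [IsRealHermitian 𝔽] (N : ℕ) :
    (Herm 𝔽 N × (Fin N → 𝔽) × ℝ) ≃+ Herm 𝔽 (N + 1) where
  toFun p := bordered p.1 p.2.1 p.2.2
  invFun x := (upperLeft 𝔽 N.le_succ x, fun i => x.1 i.castSucc (Fin.last N),
    re (x.1 (Fin.last N) (Fin.last N)))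
  left_inv p := by
    simp [upperLeft_bordered, re_algebraMap]
  right_inv x := by
    have hx : ∀ i j, star (x.1 j i) = x.1 i j := fun i j => congrFun (congrFun x.2 i) j
    ext i j
    induction i using Fin.lastCases <;> induction j using Fin.lastCases <;>
      simp [hx, algebraMap_re_of_star_eq]
    rfl
  map_add' p p' := by
    ext i j
    induction i using Fin.lastCases <;> induction j using Fin.lastCases <;> simp

theorem continuous_borderedEquiv : Continuous (borderedEquiv 𝔽 N) := by
  refine continuous_herm_iff.2 fun i j => ?_
  have hr : Continuous (algebraMap ℝ 𝔽) := continuous_algebraMap ℝ 𝔽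
  have hy := fun i j => (continuous_entry (𝔽 := 𝔽) (q := N) i j).comp
    (continuous_fst (X := Herm 𝔽 N) (Y := (Fin N → 𝔽) × ℝ))
  induction i using Fin.lastCases <;> induction j using Fin.lastCases <;>
    simp only [borderedEquiv, AddEquiv.coe_mk, Equiv.coe_fn_mk, bordered_last_last,
      bordered_castSucc_last, bordered_last_castSucc, bordered_castSucc_castSucc]
  · fun_prop
  · fun_prop
  · fun_prop
  · exact hy _ _

theorem continuous_borderedEquiv_symm : Continuous (borderedEquiv 𝔽 N).symm :=
  Continuous.prodMk (f := upperLeft 𝔽 N.le_succ)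
    (continuous_herm_iff.2 fun _ _ => continuous_entry _ _)
    ((continuous_pi fun _ => continuous_entry _ _).prodMk
      (continuous_re.comp (continuous_entry _ _)))

variable [SecondCountableTopology 𝔽] [LocallyCompactSpace 𝔽] [MeasureSpace 𝔽] [BorelSpace 𝔽]

instance : SecondCountableTopology (Matrix (Fin q) (Fin q) 𝔽) :=
  inferInstanceAs (SecondCountableTopology (Fin q → Fin q → 𝔽))

instance : BorelSpace (Matrix (Fin q) (Fin q) 𝔽) :=
  inferInstanceAs (BorelSpace (Fin q → Fin q → 𝔽))

instance : SecondCountableTopology (Herm 𝔽 q) :=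
  TopologicalSpace.Subtype.secondCountableTopology _

instance : BorelSpace (Herm 𝔽 q) := Subtype.borelSpace _

instance : LocallyCompactSpace (Herm 𝔽 q) :=
  (Homeomorph.mk (coordsEquiv 𝔽 q).toEquiv continuous_coordsEquiv
    continuous_coordsEquiv_symm).symm.isClosedEmbedding.locallyCompactSpace

instance [(volume : Measure 𝔽).IsAddHaarMeasure] : (lebesgue 𝔽 q).IsAddHaarMeasure := by
  have : (volume : Measure ((Fin q → ℝ) ×
      ({ij : Fin q × Fin q // ij.1 < ij.2} → 𝔽))).IsAddHaarMeasure :=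
    Measure.prod.instIsAddHaarMeasure _ _
  have : (Measure.map (hermOfCoords (𝔽 := 𝔽) (q := q)) volume).IsAddHaarMeasure :=
    (coordsEquiv 𝔽 q).isAddHaarMeasure_map volume continuous_coordsEquiv
      continuous_coordsEquiv_symm
  refine Measure.IsAddHaarMeasure.smul _ ?_ ENNReal.ofReal_ne_top
  exact (ENNReal.ofReal_pos.2 (by positivity)).ne'

variable [(volume : Measure 𝔽).IsAddHaarMeasure]

-- Uniqueness of Haar measure, transported along a bicontinuous additive equivalence.
variable (𝔽) in
theorem exists_lebesgue_succ_eq (N : ℕ) :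
    ∃ c : NNReal, c ≠ 0 ∧ lebesgue 𝔽 (N + 1) = c • Measure.map (borderedEquiv 𝔽 N)
      ((lebesgue 𝔽 N).prod ((volume : Measure (Fin N → 𝔽)).prod volume)) := by
  have : ((volume : Measure (Fin N → 𝔽)).prod (volume : Measure ℝ)).IsAddHaarMeasure :=
    Measure.prod.instIsAddHaarMeasure _ _
  have : ((lebesgue 𝔽 N).prod
      ((volume : Measure (Fin N → 𝔽)).prod (volume : Measure ℝ))).IsAddHaarMeasure :=
    Measure.prod.instIsAddHaarMeasure _ _
  have : (Measure.map (borderedEquiv 𝔽 N)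
      ((lebesgue 𝔽 N).prod ((volume : Measure (Fin N → 𝔽)).prod volume))).IsAddHaarMeasure :=
    (borderedEquiv 𝔽 N).isAddHaarMeasure_map _ continuous_borderedEquiv
      continuous_borderedEquiv_symm
  exact ⟨_, (Measure.addHaarScalarFactor_pos_of_isAddHaarMeasure _ _).ne',
    Measure.isAddLeftInvariant_eq_smul _ _⟩

variable (𝔽) in
theorem exists_lintegral_lebesgue_succ (N : ℕ) :
    ∃ c : NNReal, c ≠ 0 ∧ ∀ f : Herm 𝔽 (N + 1) → ENNReal, Measurable f →
      ∫⁻ x, f x ∂lebesgue 𝔽 (N + 1) =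
        c * ∫⁻ y, (∫⁻ v : Fin N → 𝔽, ∫⁻ s : ℝ, f (bordered y v s)) ∂lebesgue 𝔽 N := by
  obtain ⟨c, hc, h⟩ := exists_lebesgue_succ_eq 𝔽 N
  refine ⟨c, hc, fun f hf => ?_⟩
  have hm : Measurable (borderedEquiv 𝔽 N) := continuous_borderedEquiv.measurable
  have hfm : Measurable fun p => f (borderedEquiv 𝔽 N p) := hf.comp hm
  rw [h, lintegral_smul_measure, lintegral_map hf hm, lintegral_prod _ hfm.aemeasurable]
  congr 1
  refine lintegral_congr fun y => ?_
  exact lintegral_prod _ (hfm.comp measurable_prodMk_left).aemeasurable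

theorem measurable_realDet : Measurable fun x : Herm 𝔽 q => realDet x.1 :=
  continuous_realDet.measurable

theorem measurable_bordered (y : Herm 𝔽 N) :
    Measurable fun p : (Fin N → 𝔽) × ℝ => bordered y p.1 p.2 :=
  (continuous_borderedEquiv.comp (Continuous.prodMk_right y)).measurable

theorem measurable_bordered_right (y : Herm 𝔽 N) (v : Fin N → 𝔽) : Measurable (bordered y v) :=
  (continuous_borderedEquiv.comp (Continuous.prodMk_right y |>.comp
    (Continuous.prodMk_right v))).measurable

/-- By induction on the size: over an invertible block `y` and any column, exactly one corner entry
makes the Schur complement vanish. -/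
theorem ae_realDet_ne_zero : ∀ᵐ x ∂lebesgue 𝔽 N, realDet x.1 ≠ 0 := by
  induction N with
  | zero =>
    refine .of_forall fun x => ?_
    rw [Subsingleton.elim x.1 1, realDet_one]
    exact one_ne_zero
  | succ N ih =>
    obtain ⟨c, -, h⟩ := exists_lintegral_lebesgue_succ 𝔽 N
    have hs : MeasurableSet {x : Herm 𝔽 (N + 1) | realDet x.1 = 0} :=
      measurable_realDet (measurableSet_singleton 0)
    rw [ae_iff]
    simp only [not_not]
    rw [← lintegral_indicator_one hs, h _ (measurable_one.indicator hs)]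
    refine mul_eq_zero_of_right _ ?_
    refine (lintegral_congr_ae (g := fun _ => 0) ?_).trans lintegral_zero
    filter_upwards [ih] with y hy
    obtain ⟨z, hz, -⟩ := exists_inverse hy
    refine (lintegral_congr (g := fun _ => 0) fun v => ?_).trans lintegral_zero
    refine (lintegral_congr_ae (g := fun _ => 0) ?_).trans lintegral_zero
    have hv : v = y.1 *ᵥ (z.1 *ᵥ v) := by rw [mulVec_mulVec, hz, one_mulVec]
    filter_upwards [(measure_singleton (form y.1 (z.1 *ᵥ v) (z.1 *ᵥ v)) : volume _ = 0)
      |> compl_mem_ae_iff.2] with s hs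
    rw [Set.indicator_of_notMem]
    rw [Set.mem_ofPred_eq, hv, realDet_bordered]
    exact mul_ne_zero hy (pow_ne_zero _ (sub_ne_zero.2 hs))

theorem ae_realDet_one_sub_ne_zero : ∀ᵐ x ∂lebesgue 𝔽 N, realDet (1 - x).1 ≠ 0 :=
  (Measure.measurePreserving_sub_left (lebesgue 𝔽 N) 1).quasiMeasurePreserving.ae
    ae_realDet_ne_zero

end Lebesgue

/-! ### Scalar beta integrals, radial integrals and quadratic changes of variable. -/

section RealIntegrals

/-- The real beta integral, as an extended nonnegative real. -/
def unitBeta (α β : ℝ) : ENNReal := ∫⁻ s in Set.Icc (0 : ℝ) 1, ENNReal.ofReal (s ^ α * (1 - s) ^ β)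

theorem unitBeta_ne {α β : ℝ} (hα : -1 < α) (hβ : -1 < β) :
    unitBeta α β ≠ 0 ∧ unitBeta α β ≠ ⊤ := by
  have hb : 0 < ProbabilityTheory.beta (α + 1) (β + 1) :=
    ProbabilityTheory.beta_pos (by linarith) (by linarith)
  have h := ProbabilityTheory.lintegral_betaPDF_eq_one (α := α + 1) (β := β + 1)
    (by linarith) (by linarith)
  rw [ProbabilityTheory.lintegral_betaPDF] at h
  simp only [add_sub_cancel_right, mul_assoc,
    ENNReal.ofReal_mul (one_div_pos.2 hb).le] at h
  rw [lintegral_const_mul' _ _ ENNReal.ofReal_ne_top, setLIntegral_congr Ioo_ae_eq_Icc] at h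
  change _ * unitBeta α β = 1 at h
  constructor
  · intro h0
    simp [h0] at h
  · intro h0
    rw [h0, ENNReal.mul_top (ENNReal.ofReal_pos.2 (one_div_pos.2 hb)).ne'] at h
    simp at h

/-- The power `L ^ γ` of a positive number, extended by zero. -/
def posPow (γ L : ℝ) : ENNReal := if 0 < L then ENNReal.ofReal (L ^ γ) else 0

theorem measurable_posPow (γ : ℝ) : Measurable (posPow γ) :=
  Measurable.ite measurableSet_Ioi (by fun_prop) measurable_const

/-- Substitute s = c + (b - c)t. If b ≤ c the domain is null, which is why the right side uses the
cut-off power `posPow`. -/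
theorem lintegral_Icc_rpow_mul_rpow (α β c b : ℝ) :
    ∫⁻ s in Set.Icc c b, ENNReal.ofReal ((s - c) ^ α * (b - s) ^ β) =
      posPow (α + β + 1) (b - c) * unitBeta α β := by
  rcases lt_or_ge c b with hcb | hcb
  · have hL : 0 < b - c := sub_pos.2 hcb
    have himg : (fun t : ℝ => c + (b - c) * t) '' Set.Icc 0 1 = Set.Icc c b := by
      have := Set.image_affine_Icc' hL c 0 1
      simp only [mul_zero, zero_add, mul_one, sub_add_cancel] at this
      rw [← this]
      exact Set.image_congr fun t _ => add_comm _ _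
    have hder : ∀ t ∈ Set.Icc (0 : ℝ) 1,
        HasDerivWithinAt (fun t : ℝ => c + (b - c) * t) (b - c) (Set.Icc 0 1) t := fun t _ => by
      simpa using (((hasDerivAt_id t).const_mul (b - c)).const_add c).hasDerivWithinAt
    have hinj : Set.InjOn (fun t : ℝ => c + (b - c) * t) (Set.Icc 0 1) := fun s _ t _ h => by
      simpa [hL.ne'] using h
    rw [← himg, lintegral_image_eq_lintegral_abs_deriv_mul measurableSet_Icc hder hinj, posPow,
      if_pos hL, unitBeta, ← lintegral_const_mul' _ _ ENNReal.ofReal_ne_top]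
    refine setLIntegral_congr_fun measurableSet_Icc fun t ht => ?_
    rw [← ENNReal.ofReal_mul (abs_nonneg _), ← ENNReal.ofReal_mul (by positivity),
      abs_of_pos hL, add_sub_cancel_left, show b - (c + (b - c) * t) = (b - c) * (1 - t) by ring,
      Real.mul_rpow hL.le ht.1, Real.mul_rpow hL.le (sub_nonneg.2 ht.2), Real.rpow_add hL,
      Real.rpow_add hL, Real.rpow_one]
    congr 1
    ring
  · rw [posPow, if_neg (by linarith), zero_mul]
    refine setLIntegral_measure_zero _ _ ?_
    rw [Real.volume_Icc, ENNReal.ofReal_eq_zero]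
    linarith

/-- In polar coordinates 1 - r² = (1 + r)(1 - r), and only the factor (1 - r)^γ can be singular. -/
theorem integrable_ball_rpow {γ : ℝ} (hγ : -1 < γ) {E : Type*} [NormedAddCommGroup E]
    [NormedSpace ℝ E] [FiniteDimensional ℝ E] [MeasurableSpace E] [BorelSpace E] [Nontrivial E]
    (m : Measure E) [m.IsAddHaarMeasure] :
    IntegrableOn (fun x => (1 - ‖x‖ ^ 2) ^ γ) (Metric.ball (0 : E) 1) m := by
  rw [integrableOn_fun_norm_addHaar m (f := fun r => (1 - r ^ 2) ^ γ)]
  have h1 : IntegrableOn (fun r : ℝ => (1 - r) ^ γ) (Set.Ioo 0 1) := by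
    have h := (intervalIntegral.intervalIntegrable_rpow' (a := 0) (b := 1) hγ).comp_sub_left 1
    rw [sub_zero, sub_self] at h
    exact (h.symm.1).mono_set Set.Ioo_subset_Ioc_self
  -- On (0, 1) the factor (1 + r)^γ is at most 2^γ if γ ≥ 0 and at most 1 if γ ≤ 0; the sum covers
  -- both cases.
  refine Integrable.mono' (h1.const_mul (2 ^ γ + 1)) (by fun_prop) ?_
  refine (ae_restrict_mem measurableSet_Ioo).mono fun r hr => ?_
  have h0 : 0 < 1 - r := sub_pos.2 hr.2
  have h2 : 0 < 1 + r := by linarith [hr.1]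
  have h3 : (1 + r) ^ γ ≤ 2 ^ γ + 1 := by
    rcases le_total 0 γ with h | h
    · have := Real.rpow_le_rpow h2.le (by linarith [hr.2] : 1 + r ≤ 2) h
      linarith
    · have := Real.rpow_le_one_of_one_le_of_nonpos (by linarith [hr.1] : 1 ≤ 1 + r) h
      have : (0 : ℝ) ≤ 2 ^ γ := by positivity
      linarith
  have h4 : (0 : ℝ) ≤ (1 - r) ^ γ := by positivity
  have h5 : r ^ (Module.finrank ℝ E - 1) ≤ 1 := pow_le_one₀ hr.1.le hr.2.le
  have h6 : 0 ≤ r ^ (Module.finrank ℝ E - 1) := pow_nonneg hr.1.le _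
  rw [show 1 - r ^ 2 = (1 + r) * (1 - r) by ring, Real.mul_rpow h2.le h0.le, smul_eq_mul,
    Real.norm_of_nonneg (by positivity)]
  calc _ ≤ 1 * ((1 + r) ^ γ * (1 - r) ^ γ) := by gcongr
    _ ≤ _ := by rw [one_mul]; gcongr

theorem lintegral_posPow_ne {γ : ℝ} (hγ : -1 < γ) (ι : Type*) [Fintype ι] :
    (∫⁻ x : ι → ℝ, posPow γ (1 - x ⬝ᵥ x)) ≠ 0 ∧ (∫⁻ x : ι → ℝ, posPow γ (1 - x ⬝ᵥ x)) ≠ ⊤ := by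
  have hcont : Continuous fun x : ι → ℝ => x ⬝ᵥ x := continuous_id.dotProduct continuous_id
  have hm : Measurable fun x : ι → ℝ => posPow γ (1 - x ⬝ᵥ x) :=
    (measurable_posPow γ).comp (measurable_const.sub hcont.measurable)
  constructor
  · refine (lintegral_pos_iff_support hm |>.2 ?_).ne'
    have ho : IsOpen {x : ι → ℝ | x ⬝ᵥ x < 1} := isOpen_lt hcont continuous_const
    refine (ho.measure_pos volume ⟨0, by simp⟩).trans_le (measure_mono fun x hx => ?_)
    have hx : 0 < 1 - x ⬝ᵥ x := sub_pos.2 hx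
    have : 0 < (1 - x ⬝ᵥ x) ^ γ := Real.rpow_pos_of_pos hx γ
    simp [posPow, this, sub_pos.1 hx]
  -- Polar coordinates need a nontrivial space, so the one-point space is separate.
  · rcases isEmpty_or_nonempty ι with h | h
    · rw [lintegral_congr (g := fun _ => 1) fun x => by simp [posPow, dotProduct], lintegral_one]
      exact measure_ne_top _ _
    · have h1 := (integrable_ball_rpow hγ (volume : Measure (EuclideanSpace ℝ ι))).2
      rw [← (PiLp.volume_preserving_ofLp ι).lintegral_comp hm]
      have h2 : ∀ x : EuclideanSpace ℝ ι, x.ofLp ⬝ᵥ x.ofLp = ‖x‖ ^ 2 := fun x => by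
        rw [EuclideanSpace.real_norm_sq_eq]
        simp [dotProduct, sq]
      refine ne_of_lt (lt_of_eq_of_lt ?_ h1)
      rw [← lintegral_indicator Metric.isOpen_ball.measurableSet]
      refine lintegral_congr fun x => ?_
      have h3 : 0 < 1 - ‖x‖ ^ 2 ↔ x ∈ Metric.ball (0 : EuclideanSpace ℝ ι) 1 := by
        rw [mem_ball_zero_iff, sub_pos, sq_lt_one_iff₀ (norm_nonneg x)]
      rw [posPow, h2]
      by_cases h4 : x ∈ Metric.ball (0 : EuclideanSpace ℝ ι) 1
      · rw [if_pos (h3.2 h4), Set.indicator_of_mem h4,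
          Real.enorm_of_nonneg (Real.rpow_nonneg (h3.2 h4).le γ)]
      · rw [if_neg fun h => h4 (h3.1 h), Set.indicator_of_notMem h4]

-- Factor G = BᵀB and substitute Bx; the Jacobian is |det B|⁻¹ = (det G)^(-1/2).
open scoped MatrixOrder in
theorem lintegral_comp_quadratic {ι : Type*} [Fintype ι] [DecidableEq ι] {G : Matrix ι ι ℝ}
    (hG : G.PosDef) {f : ℝ → ENNReal} (hf : Measurable f) :
    ∫⁻ x : ι → ℝ, f (x ⬝ᵥ (G *ᵥ x)) =
      ENNReal.ofReal (G.det ^ (-(1 / 2) : ℝ)) * ∫⁻ x : ι → ℝ, f (x ⬝ᵥ x) := by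
  obtain ⟨B, rfl⟩ := CStarAlgebra.nonneg_iff_eq_star_mul_self.mp hG.posSemidef.nonneg
  have hdet : (star B * B).det = B.det ^ 2 := by
    rw [det_mul, star_eq_conjTranspose, det_conjTranspose, star_trivial, sq]
  have hB : B.det ≠ 0 := fun h => hG.det_pos.ne' (by rw [hdet, h]; simp)
  have hq : ∀ x : ι → ℝ, x ⬝ᵥ ((star B * B) *ᵥ x) = toLin' B x ⬝ᵥ toLin' B x := fun x => by
    rw [toLin'_apply, ← mulVec_mulVec, star_eq_conjTranspose, conjTranspose_eq_transpose_of_trivial,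
      dotProduct_mulVec, vecMul_transpose]
  have hcont : Continuous fun x : ι → ℝ => x ⬝ᵥ x := continuous_id.dotProduct continuous_id
  simp_rw [hq]
  rw [← lintegral_map (f := fun x : ι → ℝ => f (x ⬝ᵥ x)) (hf.comp hcont.measurable)
    (LinearMap.continuous_on_pi _).measurable, Real.map_matrix_volume_pi_eq_smul_volume_pi hB,
    lintegral_smul_measure, smul_eq_mul, hdet]
  congr 2
  rw [← sq_abs, ← Real.rpow_natCast, ← Real.rpow_mul (abs_nonneg _), abs_inv]
  norm_num [Real.rpow_neg_one]

end RealIntegrals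

/-! ### Integrating a function of a Hermitian form over column space. -/

section QuadraticForm

variable (𝔽 : Type*) [DivisionRing 𝔽] [StarRing 𝔽] [Algebra ℝ 𝔽] [StarModule ℝ 𝔽]
  [IsRealHermitian 𝔽] [Module.Finite ℝ 𝔽] [TopologicalSpace 𝔽] [IsTopologicalRing 𝔽]
  [ContinuousSMul ℝ 𝔽] [ContinuousStar 𝔽] [T2Space 𝔽]
  [SecondCountableTopology 𝔽] [LocallyCompactSpace 𝔽] [MeasureSpace 𝔽] [BorelSpace 𝔽]
  [(volume : Measure 𝔽).IsAddHaarMeasure] (N : ℕ)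

/-- The point is that `κ` does not depend on `z`, since `z` will vary with the block `y`. It absorbs
the choice of basis and the scaling of Haar measure. -/
theorem exists_lintegral_comp_form :
    ∃ κ : ENNReal, κ ≠ 0 ∧ κ ≠ ⊤ ∧ ∀ z : Herm 𝔽 N, (∀ v, v ≠ 0 → 0 < form z.1 v v) →
      ∀ f : ℝ → ENNReal, Measurable f → ∫⁻ v : Fin N → 𝔽, f (form z.1 v v) =
        κ * ENNReal.ofReal (realDet z.1 ^ (-(1 / 2) : ℝ)) *
          ∫⁻ x : Fin (Module.finrank ℝ (Fin N → 𝔽)) → ℝ, f (x ⬝ᵥ x) := by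
  let b := Module.finBasis ℝ (Fin N → 𝔽)
  let e := b.equivFun.toContinuousLinearEquiv
  obtain ⟨k, hk, h⟩ : ∃ k : NNReal, k ≠ 0 ∧
      Measure.map e (volume : Measure (Fin N → 𝔽)) = k • volume := by
    have : (Measure.map e (volume : Measure (Fin N → 𝔽))).IsAddHaarMeasure :=
      e.toLinearEquiv.toAddEquiv.isAddHaarMeasure_map _ e.continuous e.symm.continuous
    exact ⟨_, (Measure.addHaarScalarFactor_pos_of_isAddHaarMeasure _ _).ne',
      Measure.isAddLeftInvariant_eq_smul _ _⟩
  have hg := det_gram_one_pos b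
  refine ⟨k * ENNReal.ofReal ((gram b 1).det ^ (-(1 / 2) : ℝ)), ?_, ?_, fun z hz f hf => ?_⟩
  · refine mul_ne_zero (by simpa using hk) (ENNReal.ofReal_pos.2 (by positivity)).ne'
  · exact ENNReal.mul_ne_top ENNReal.coe_ne_top ENNReal.ofReal_ne_top
  · have hG := posDef_gram b hz
    have hz0 : 0 ≤ realDet z.1 := by
      have := hG.det_pos
      rw [det_gram] at this
      exact (pos_of_mul_pos_right this hg.le).le
    have hcont : Continuous fun x : Fin (Module.finrank ℝ (Fin N → 𝔽)) → ℝ =>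
        x ⬝ᵥ (gram b z.1 *ᵥ x) :=
      continuous_id.dotProduct (continuous_const.matrix_mulVec continuous_id)
    have h1 : ∫⁻ v : Fin N → 𝔽, f (form z.1 v v) =
        ∫⁻ v : Fin N → 𝔽, f (e v ⬝ᵥ (gram b z.1 *ᵥ e v)) :=
      lintegral_congr fun v => by rw [form_eq_gram b]; rfl
    rw [h1, ← lintegral_map (f := fun x => f (x ⬝ᵥ (gram b z.1 *ᵥ x)))
      (hf.comp hcont.measurable) e.continuous.measurable, h, lintegral_smul_measure,
      lintegral_comp_quadratic hG hf, det_gram, Real.mul_rpow hg.le hz0,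
      ENNReal.ofReal_mul (by positivity), ENNReal.smul_def, smul_eq_mul]
    ring

end QuadraticForm

/-! ### Integrating the beta kernel over the last row and column. -/

section Kernel

variable {𝔽 : Type*} [DivisionRing 𝔽] [StarRing 𝔽] [Algebra ℝ 𝔽] [StarModule ℝ 𝔽]
  [IsRealHermitian 𝔽] [Module.Finite ℝ 𝔽] [TopologicalSpace 𝔽] [IsTopologicalRing 𝔽]
  [ContinuousSMul ℝ 𝔽] [ContinuousStar 𝔽] [T2Space 𝔽]
  [SecondCountableTopology 𝔽] [LocallyCompactSpace 𝔽] [MeasureSpace 𝔽] [BorelSpace 𝔽]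
  [(volume : Measure 𝔽).IsAddHaarMeasure] {N q : ℕ}

/-- The density `Δ(x)^α Δ(1 - x)^β` on `Π_q^I`, extended by zero to all Hermitian matrices. -/
def kernel (α β : ℝ) : Herm 𝔽 q → ENNReal :=
  (coneInterval 𝔽 q).indicator fun x =>
    ENNReal.ofReal (coneDet x.1 ^ α * coneDet (1 - x).1 ^ β)

theorem measurable_coneDet : Measurable fun x : Herm 𝔽 q => coneDet x.1 :=
  measurable_realDet.pow_const _

theorem measurable_coneDet_rpow_mul (α β : ℝ) :
    Measurable fun x : Herm 𝔽 q => coneDet x.1 ^ α * coneDet (1 - x).1 ^ β :=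
  (measurable_coneDet.pow_const _).mul
    ((measurable_coneDet.comp continuous_one_sub.measurable).pow_const _)

theorem measurable_kernel (α β : ℝ) : Measurable (kernel (𝔽 := 𝔽) (q := q) α β) :=
  (measurable_coneDet_rpow_mul α β).ennreal_ofReal.indicator
    isClosed_coneInterval.measurableSet

theorem coneDet_nonneg {x : Herm 𝔽 q} (hx : x ∈ cone 𝔽 q) : 0 ≤ coneDet x.1 :=
  Real.rpow_nonneg (realDet_nonneg hx) _

/-- With v = y(zv) and -v = (1 - y)(-z'v), the Schur complements of `x` and `1 - x` are affine in
`s` with slopes 1 and -1. Their nonnegativity confines `s` to an interval, on which the kernel is a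
scalar beta integrand. -/
theorem lintegral_kernel_bordered {y : Herm 𝔽 N} (hy : y ∈ coneInterval 𝔽 N) {z z' : Herm 𝔽 N}
    (hz : y.1 * z.1 = 1) (hz' : (1 - y).1 * z'.1 = 1) (α β : ℝ) (v : Fin N → 𝔽) :
    ∫⁻ s : ℝ, kernel α β (bordered y v s) = kernel α β y *
      (posPow (α + β + 1) (1 - form (z + z').1 v v) * unitBeta α β) := by
  have hv : v = y.1 *ᵥ (z.1 *ᵥ v) := by rw [mulVec_mulVec, hz, one_mulVec]
  have hv' : -v = (1 - y).1 *ᵥ (-(z'.1 *ᵥ v)) := by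
    rw [mulVec_neg, mulVec_mulVec, hz', one_mulVec]
  have hf : ∀ w w' : Herm 𝔽 N, w.1 * w'.1 = 1 → form w.1 (w'.1 *ᵥ v) (w'.1 *ᵥ v) = form w'.1 v v :=
    fun w w' h => by
      rw [form, mulVec_mulVec, h, one_mulVec, star_mulVec_dotProduct, form]
  have hfz := hf y z hz
  have hfz' : form (1 - y).1 (-(z'.1 *ᵥ v)) (-(z'.1 *ᵥ v)) = form z'.1 v v := by
    rw [← hf (1 - y) z' hz']
    simp [form, mulVec_neg]
  have hmem : ∀ s, bordered y v s ∈ coneInterval 𝔽 (N + 1) ↔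
      s ∈ Set.Icc (form z.1 v v) (1 - form z'.1 v v) := by
    intro s
    rw [coneInterval, Set.mem_ofPred_eq, one_sub_bordered]
    conv_lhs => rw [hv']
    conv_lhs => lhs; rw [hv]
    rw [bordered_mem_cone_iff hy.1, bordered_mem_cone_iff hy.2, hfz, hfz', Set.mem_Icc,
      le_sub_comm]
  have hker : ∀ s, kernel α β (bordered y v s) = kernel α β y *
      (Set.Icc (form z.1 v v) (1 - form z'.1 v v)).indicator (fun s =>
        ENNReal.ofReal ((s - form z.1 v v) ^ α * (1 - form z'.1 v v - s) ^ β)) s := by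
    intro s
    by_cases hs : s ∈ Set.Icc (form z.1 v v) (1 - form z'.1 v v)
    · have h1 : coneDet (bordered y v s).1 = coneDet y.1 * (s - form z.1 v v) := by
        conv_lhs => rw [hv]
        rw [coneDet_bordered hy.1 _ (by rw [hfz]; exact hs.1), hfz]
      have h2 : coneDet (1 - bordered y v s).1 =
          coneDet (1 - y).1 * (1 - form z'.1 v v - s) := by
        rw [one_sub_bordered]
        conv_lhs => rw [hv']
        rw [coneDet_bordered hy.2 _ (by rw [hfz']; exact le_sub_comm.1 hs.2), hfz']
        ring
      have h3 := coneDet_nonneg hy.1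
      have h4 := coneDet_nonneg hy.2
      have h5 := sub_nonneg.2 hs.1
      have h6 := sub_nonneg.2 hs.2
      rw [kernel, kernel, Set.indicator_of_mem ((hmem s).2 hs), Set.indicator_of_mem hy,
        Set.indicator_of_mem hs, h1, h2, Real.mul_rpow h3 h5, Real.mul_rpow h4 h6,
        ← ENNReal.ofReal_mul (by positivity)]
      congr 1
      ring
    · rw [kernel, Set.indicator_of_notMem fun h => hs ((hmem s).1 h),
        Set.indicator_of_notMem hs, mul_zero]
  have hne : kernel α β y ≠ ⊤ := by
    rw [kernel, Set.indicator_of_mem hy]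
    exact ENNReal.ofReal_ne_top
  simp_rw [hker]
  rw [lintegral_const_mul' _ _ hne, lintegral_indicator measurableSet_Icc,
    lintegral_Icc_rpow_mul_rpow]
  congr 3
  change _ = 1 - form (z.1 + z'.1) v v
  rw [form_add_mat]
  ring

theorem realDet_eq_coneDet_pow {x : Herm 𝔽 q} (hx : x ∈ cone 𝔽 q) :
    realDet x.1 = coneDet x.1 ^ (realDim 𝔽 : ℝ) := by
  have hd : (realDim 𝔽 : ℝ) ≠ 0 :=
    Nat.cast_ne_zero.2 (Module.finrank_pos (R := ℝ) (M := 𝔽)).ne'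
  rw [coneDet, ← Real.rpow_mul (realDet_nonneg hx), inv_mul_cancel₀ hd, Real.rpow_one]

variable (𝔽) in
theorem exists_lintegral_kernel_bordered (N : ℕ) {α β : ℝ} (hα : -1 < α) (hβ : -1 < β) :
    ∃ C : ENNReal, C ≠ 0 ∧ C ≠ ⊤ ∧ ∀ᵐ y ∂lebesgue 𝔽 N,
      ∫⁻ v : Fin N → 𝔽, ∫⁻ s : ℝ, kernel α β (bordered y v s) =
        C * kernel (α + realDim 𝔽 / 2) (β + realDim 𝔽 / 2) y := by
  obtain ⟨κ, hκ, hκ', h⟩ := exists_lintegral_comp_form 𝔽 N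
  obtain ⟨hB, hB'⟩ := unitBeta_ne hα hβ
  obtain ⟨hI, hI'⟩ := lintegral_posPow_ne (γ := α + β + 1) (by linarith)
    (Fin (Module.finrank ℝ (Fin N → 𝔽)))
  refine ⟨κ * (∫⁻ x : Fin (Module.finrank ℝ (Fin N → 𝔽)) → ℝ, posPow (α + β + 1) (1 - x ⬝ᵥ x)) *
    unitBeta α β, mul_ne_zero (mul_ne_zero hκ hI) hB,
    ENNReal.mul_ne_top (ENNReal.mul_ne_top hκ' hI') hB', ?_⟩
  filter_upwards [ae_realDet_ne_zero, ae_realDet_one_sub_ne_zero] with y hd hd'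
  by_cases hy : y ∈ coneInterval 𝔽 N
  · obtain ⟨z, hz, hzy⟩ := exists_inverse hd
    obtain ⟨z', hz', -⟩ := exists_inverse hd'
    simp_rw [lintegral_kernel_bordered hy hz hz']
    have hne : kernel α β y ≠ ⊤ := by
      rw [kernel, Set.indicator_of_mem hy]
      exact ENNReal.ofReal_ne_top
    -- Insert 1 = (1 - y) + y between z and z'.
    have hadd : (z + z').1 = z.1 * z'.1 := by
      change z.1 + z'.1 = _
      have h1 : (1 - y.1) * z'.1 = 1 := hz'
      calc z.1 + z'.1 = z.1 * ((1 - y.1) * z'.1) + (z.1 * y.1) * z'.1 := by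
            rw [h1, hzy, mul_one, one_mul]
        _ = z.1 * z'.1 := by noncomm_ring
    have hpos : ∀ (w w' : Herm 𝔽 N), w ∈ cone 𝔽 N → realDet w.1 ≠ 0 → w.1 * w'.1 = 1 →
        ∀ v, v ≠ 0 → 0 < form w'.1 v v := by
      intro w w' hw hwd hww v hv
      have h1 : w.1 *ᵥ (w'.1 *ᵥ v) = v := by rw [mulVec_mulVec, hww, one_mulVec]
      have h2 : w'.1 *ᵥ v ≠ 0 := fun h0 => hv (by rw [← h1, h0, mulVec_zero])
      have h3 := form_pos_of_realDet_ne_zero hw hwd h2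
      rwa [form, h1, star_mulVec_dotProduct] at h3
    have hzz : ∀ v, v ≠ 0 → 0 < form (z + z').1 v v := fun v hv => by
      change 0 < form (z.1 + z'.1) v v
      rw [form_add_mat]
      exact add_pos (hpos y z hy.1 hd hz v hv) (hpos _ z' hy.2 hd' hz' v hv)
    have hdy : 0 < realDet y.1 := (realDet_nonneg hy.1).lt_of_ne' hd
    have hdy' : 0 < realDet (1 - y).1 := (realDet_nonneg hy.2).lt_of_ne' hd'
    have hdet : realDet (z + z').1 = (realDet y.1 * realDet (1 - y).1)⁻¹ := by
      have h1 : realDet y.1 * realDet z.1 = 1 := by rw [← realDet_mul, hz, realDet_one]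
      have h2 : realDet (1 - y).1 * realDet z'.1 = 1 := by rw [← realDet_mul, hz', realDet_one]
      rw [hadd, realDet_mul, mul_inv, eq_inv_of_mul_eq_one_right h1,
        eq_inv_of_mul_eq_one_right h2]
    have hmeas : Measurable fun t => posPow (α + β + 1) (1 - t) :=
      (measurable_posPow _).comp (measurable_const.sub measurable_id)
    rw [lintegral_const_mul' _ _ hne, lintegral_mul_const' _ _ hB',
      h (z + z') hzz (fun t => posPow (α + β + 1) (1 - t)) hmeas, hdet]
    have hc := coneDet_nonneg hy.1
    have hc' := coneDet_nonneg hy.2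
    have hc0 : 0 < coneDet y.1 := Real.rpow_pos_of_pos hdy _
    have hc0' : 0 < coneDet (1 - y).1 := Real.rpow_pos_of_pos hdy' _
    -- The real determinant is Δ^d, so its square root contributes d/2 to each exponent.
    have hker : kernel (α + realDim 𝔽 / 2) (β + realDim 𝔽 / 2) y = kernel α β y *
        ENNReal.ofReal ((realDet y.1 * realDet (1 - y).1)⁻¹ ^ (-(1 / 2) : ℝ)) := by
      rw [kernel, kernel, Set.indicator_of_mem hy, Set.indicator_of_mem hy,
        ← ENNReal.ofReal_mul (by positivity), ← Real.rpow_neg_eq_inv_rpow, neg_neg,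
        Real.mul_rpow hdy.le hdy'.le, realDet_eq_coneDet_pow hy.1, realDet_eq_coneDet_pow hy.2,
        ← Real.rpow_mul hc, ← Real.rpow_mul hc', Real.rpow_add hc0, Real.rpow_add hc0']
      simp only [mul_one_div]
      congr 1
      ring
    rw [hker]
    ring
  -- If `y` is outside the interval, so is every matrix bordering it, and both sides vanish.
  · have h0 : ∀ v s, kernel α β (bordered y v s) = 0 := fun v s => by
      refine Set.indicator_of_notMem (fun hm => hy ?_) _
      refine ⟨upperLeft_mem_cone_of_bordered hm.1, ?_⟩
      have := hm.2
      rw [one_sub_bordered] at this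
      exact upperLeft_mem_cone_of_bordered this
    simp_rw [h0]
    simp [kernel, hy]

theorem measurable_upperLeft {p : ℕ} (h : q ≤ p) : Measurable (upperLeft 𝔽 h) :=
  (continuous_herm_iff.2 fun _ _ => continuous_entry _ _ : Continuous (upperLeft 𝔽 h)).measurable

theorem lintegral_const_mul_kernel_bordered (α β : ℝ) (y : Herm 𝔽 N) (a : ENNReal) :
    (∫⁻ v : Fin N → 𝔽, ∫⁻ s : ℝ, a * kernel α β (bordered y v s)) =
      a * ∫⁻ v : Fin N → 𝔽, ∫⁻ s : ℝ, kernel α β (bordered y v s) := by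
  have hk : Measurable fun w : (Fin N → 𝔽) × ℝ => kernel α β (bordered y w.1 w.2) :=
    (measurable_kernel α β).comp (measurable_bordered y)
  rw [← lintegral_const_mul _ hk.lintegral_prod_right']
  refine lintegral_congr fun v => ?_
  have hkv : Measurable fun s : ℝ => kernel α β (bordered y v s) :=
    (measurable_kernel α β).comp (measurable_bordered_right y v)
  exact lintegral_const_mul a hkv

-- Induction on `p`. The function `g` sees only the upper left block, so it is constant in the last
-- column and corner and comes out of the inner integrals; hence `C` does not depend on `g`.
variable (𝔽) in
theorem exists_lintegral_upperLeft_mul_kernel {p : ℕ} (hqp : q ≤ p) {α β : ℝ}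
    (hα : -1 < α) (hβ : -1 < β) :
    ∃ C : ENNReal, C ≠ 0 ∧ C ≠ ⊤ ∧ ∀ g : Herm 𝔽 q → ENNReal, Measurable g →
      ∫⁻ x, g (upperLeft 𝔽 hqp x) * kernel α β x ∂lebesgue 𝔽 p =
        C * ∫⁻ y, g y * kernel (α + realDim 𝔽 / 2 * (p - q)) (β + realDim 𝔽 / 2 * (p - q)) y
          ∂lebesgue 𝔽 q := by
  induction p, hqp using Nat.le_induction generalizing α β with
  | base =>
    refine ⟨1, one_ne_zero, ENNReal.one_ne_top, fun g _ => ?_⟩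
    simp only [sub_self, mul_zero, add_zero, one_mul]
    rfl
  | succ p hqp ih =>
    have hd : (0 : ℝ) ≤ realDim 𝔽 / 2 := by positivity
    -- Peeling off the last row and column shifts the exponents first, so the smaller case is needed
    -- at the shifted values.
    obtain ⟨C, hC, hC', h⟩ := ih (α := α + realDim 𝔽 / 2) (β := β + realDim 𝔽 / 2)
      (by linarith) (by linarith)
    obtain ⟨c, hc, hs⟩ := exists_lintegral_lebesgue_succ 𝔽 p
    obtain ⟨D, hD, hD', hk⟩ := exists_lintegral_kernel_bordered 𝔽 p hα hβ
    refine ⟨c * D * C, mul_ne_zero (mul_ne_zero (by simpa using hc) hD) hC,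
      ENNReal.mul_ne_top (ENNReal.mul_ne_top ENNReal.coe_ne_top hD') hC', fun g hg => ?_⟩
    have hul : ∀ y v s, upperLeft 𝔽 (hqp.trans p.le_succ) (bordered y v s) =
        upperLeft 𝔽 hqp y := fun y v s => by
      conv_rhs => rw [← upperLeft_bordered y v s]
      rfl
    have hgm : Measurable fun x => g (upperLeft 𝔽 (hqp.trans p.le_succ) x) * kernel α β x :=
      (hg.comp (measurable_upperLeft _)).mul (measurable_kernel _ _)
    rw [hs _ hgm]
    have key : ∀ᵐ y ∂lebesgue 𝔽 p, (∫⁻ v : Fin p → 𝔽, ∫⁻ s : ℝ,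
        g (upperLeft 𝔽 (hqp.trans p.le_succ) (bordered y v s)) * kernel α β (bordered y v s)) =
        D * (g (upperLeft 𝔽 hqp y) * kernel (α + realDim 𝔽 / 2) (β + realDim 𝔽 / 2) y) := by
      filter_upwards [hk] with y hy
      simp_rw [hul]
      rw [lintegral_const_mul_kernel_bordered, hy]
      ring
    rw [lintegral_congr_ae key, lintegral_const_mul, h g hg]
    · push_cast
      rw [show α + realDim 𝔽 / 2 + realDim 𝔽 / 2 * ((p : ℝ) - q) =
          α + realDim 𝔽 / 2 * ((p : ℝ) + 1 - q) by ring,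
        show β + realDim 𝔽 / 2 + realDim 𝔽 / 2 * ((p : ℝ) - q) =
          β + realDim 𝔽 / 2 * ((p : ℝ) + 1 - q) by ring]
      ring
    · exact (hg.comp (measurable_upperLeft _)).mul (measurable_kernel _ _)

end Kernel

/-! ### Normalization and the push-forward. -/

section Beta

variable {𝔽 : Type*} [DivisionRing 𝔽] [StarRing 𝔽] [Algebra ℝ 𝔽] [StarModule ℝ 𝔽]
  [IsRealHermitian 𝔽] [Module.Finite ℝ 𝔽] [TopologicalSpace 𝔽] [IsTopologicalRing 𝔽]
  [ContinuousSMul ℝ 𝔽] [ContinuousStar 𝔽] [T2Space 𝔽]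
  [SecondCountableTopology 𝔽] [LocallyCompactSpace 𝔽] [MeasureSpace 𝔽] [BorelSpace 𝔽]
  [(volume : Measure 𝔽).IsAddHaarMeasure] {p q : ℕ}

/-- Project onto the empty block: H₀ is a single point on which the kernel is 1, so the integral is
`C` times a finite nonzero mass. -/
theorem lintegral_kernel_ne {α β : ℝ} (hα : -1 < α) (hβ : -1 < β) :
    (∫⁻ x, kernel α β x ∂lebesgue 𝔽 q) ≠ 0 ∧ (∫⁻ x, kernel α β x ∂lebesgue 𝔽 q) ≠ ⊤ := by
  obtain ⟨C, hC, hC', h⟩ := exists_lintegral_upperLeft_mul_kernel 𝔽 q.zero_le hα hβ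
  have h0 : ∀ (α β : ℝ) (y : Herm 𝔽 0), kernel α β y = 1 := by
    intro α β y
    have hc : ∀ x : Herm 𝔽 0, x ∈ cone 𝔽 0 := fun x =>
      (mem_cone_iff x).2 fun v => by simp [form]
    have hd : ∀ x : Herm 𝔽 0, coneDet x.1 = 1 := fun x => by
      change realDet x.1 ^ _ = _
      rw [Subsingleton.elim x.1 1, realDet_one, Real.one_rpow]
    have hy : y ∈ coneInterval 𝔽 0 := ⟨hc y, hc (1 - y)⟩
    rw [kernel, Set.indicator_of_mem hy]
    simp only [hd, Real.one_rpow, mul_one, ENNReal.ofReal_one]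
  have h1 := h (fun _ => 1) measurable_const
  simp only [one_mul, h0, lintegral_one] at h1
  have : Nonempty (Herm 𝔽 0) := ⟨0⟩
  rw [h1]
  exact ⟨mul_ne_zero hC (Measure.measure_univ_ne_zero.2 (NeZero.ne _)),
    ENNReal.mul_ne_top hC' (measure_ne_top _ _)⟩

theorem lintegral_mul_betaKernel (μ ν : ℝ) (f : Herm 𝔽 q → ENNReal) :
    ∫⁻ y : coneInterval 𝔽 q, f y * ENNReal.ofReal (betaKernel μ ν y) ∂lebesgueI 𝔽 q =
      ∫⁻ x, f x * kernel (μ - hermDim 𝔽 q / q) (ν - hermDim 𝔽 q / q) x ∂lebesgue 𝔽 q := by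
  have hs : MeasurableSet (coneInterval 𝔽 q) := isClosed_coneInterval.measurableSet
  refine (lintegral_subtype_comap hs fun x => f x * ENNReal.ofReal
    (coneDet x.1 ^ (μ - hermDim 𝔽 q / q) * coneDet (1 - x).1 ^ (ν - hermDim 𝔽 q / q))).trans ?_
  rw [← lintegral_indicator hs]
  refine lintegral_congr fun x => ?_
  rw [kernel, Set.indicator_mul_right]

theorem betaKernel_nonneg (μ ν : ℝ) (y : coneInterval 𝔽 q) : 0 ≤ betaKernel μ ν y :=
  mul_nonneg (Real.rpow_nonneg (coneDet_nonneg y.2.1) _)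
    (Real.rpow_nonneg (coneDet_nonneg y.2.2) _)

theorem measurable_betaKernel (μ ν : ℝ) :
    Measurable (betaKernel μ ν : coneInterval 𝔽 q → ℝ) :=
  (measurable_coneDet_rpow_mul _ _).comp measurable_subtype_coe

theorem betaIntegral_eq (μ ν : ℝ) : betaIntegral 𝔽 q μ ν =
    (∫⁻ x, kernel (μ - hermDim 𝔽 q / q) (ν - hermDim 𝔽 q / q) x ∂lebesgue 𝔽 q).toReal := by
  rw [betaIntegral, integral_eq_lintegral_of_nonneg_ae (.of_forall (betaKernel_nonneg μ ν))
    (measurable_betaKernel μ ν).aestronglyMeasurable]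
  have := lintegral_mul_betaKernel (𝔽 := 𝔽) (q := q) μ ν fun _ => 1
  simp only [one_mul] at this
  rw [this]

/-- Every measurable subset of the cone interval is such a preimage. Finiteness of the mass is what
identifies the Bochner normalization `betaIntegral` with the extended integral. -/
theorem beta_preimage_val {μ ν : ℝ} (hμ : -1 < μ - hermDim 𝔽 q / q)
    (hν : -1 < ν - hermDim 𝔽 q / q) {t : Set (Herm 𝔽 q)} (ht : MeasurableSet t) :
    beta 𝔽 q μ ν (Subtype.val ⁻¹' t) =
      (∫⁻ x, kernel (μ - hermDim 𝔽 q / q) (ν - hermDim 𝔽 q / q) x ∂lebesgue 𝔽 q)⁻¹ *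
      ∫⁻ x, t.indicator 1 x * kernel (μ - hermDim 𝔽 q / q) (ν - hermDim 𝔽 q / q) x
        ∂lebesgue 𝔽 q := by
  obtain ⟨h0, h1⟩ := lintegral_kernel_ne (𝔽 := 𝔽) (q := q) hμ hν
  have hpos : 0 < betaIntegral 𝔽 q μ ν := by
    rw [betaIntegral_eq]
    exact ENNReal.toReal_pos h0 h1
  have hc : ENNReal.ofReal (betaIntegral 𝔽 q μ ν)⁻¹ =
      (∫⁻ x, kernel (μ - hermDim 𝔽 q / q) (ν - hermDim 𝔽 q / q) x ∂lebesgue 𝔽 q)⁻¹ := by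
    rw [ENNReal.ofReal_inv_of_pos hpos, betaIntegral_eq, ENNReal.ofReal_toReal h1]
  have hm : MeasurableSet (Subtype.val ⁻¹' t : Set (coneInterval 𝔽 q)) :=
    measurable_subtype_coe ht
  rw [beta, withDensity_apply _ hm, ← lintegral_indicator hm, ← lintegral_mul_betaKernel, ← hc,
    ← lintegral_const_mul' _ _ ENNReal.ofReal_ne_top]
  refine lintegral_congr fun y => ?_
  by_cases hy : y.1 ∈ t
  · rw [Set.indicator_of_mem (show y ∈ Subtype.val ⁻¹' t from hy), Set.indicator_of_mem hy,
      Pi.one_apply, one_mul, ENNReal.ofReal_mul (inv_nonneg.2 hpos.le)]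
  · rw [Set.indicator_of_notMem (show y ∉ Subtype.val ⁻¹' t from hy), Set.indicator_of_notMem hy,
      zero_mul, mul_zero]

theorem isProbabilityMeasure_beta {μ ν : ℝ} (hμ : -1 < μ - hermDim 𝔽 q / q)
    (hν : -1 < ν - hermDim 𝔽 q / q) : IsProbabilityMeasure (beta 𝔽 q μ ν) := by
  obtain ⟨h0, h1⟩ := lintegral_kernel_ne (𝔽 := 𝔽) (q := q) hμ hν
  have := beta_preimage_val hμ hν MeasurableSet.univ
  simp only [Set.indicator_univ, Pi.one_apply, one_mul, Set.preimage_univ,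
    ENNReal.inv_mul_cancel h0 h1] at this
  exact ⟨this⟩

theorem measurable_proj (h : q ≤ p) : Measurable (proj 𝔽 h) :=
  ((measurable_upperLeft h).comp measurable_subtype_coe).subtype_mk

theorem map_proj_beta (h : q ≤ p) {μ ν : ℝ}
    (hμp : -1 < μ - hermDim 𝔽 p / p) (hνp : -1 < ν - hermDim 𝔽 p / p)
    (hμq : -1 < μ - hermDim 𝔽 q / q) (hνq : -1 < ν - hermDim 𝔽 q / q)
    (hpq : hermDim 𝔽 p / p - hermDim 𝔽 q / q = realDim 𝔽 / 2 * (p - q)) :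
    Measure.map (proj 𝔽 h) (beta 𝔽 p μ ν) = beta 𝔽 q μ ν := by
  obtain ⟨C, hC, hC', hint⟩ := exists_lintegral_upperLeft_mul_kernel 𝔽 h hμp hνp
  rw [← hpq, sub_add_sub_cancel, sub_add_sub_cancel] at hint
  -- The test function 1 compares the total masses and an indicator compares the measures of a set,
  -- with the same `C`, which then cancels.
  have hmass := hint (fun _ => 1) measurable_const
  simp only [one_mul] at hmass
  ext s hs
  obtain ⟨t, ht, rfl⟩ := hs
  have ht' : MeasurableSet (upperLeft 𝔽 h ⁻¹' t) := measurable_upperLeft h ht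
  rw [Measure.map_apply (measurable_proj h) (measurable_subtype_coe ht)]
  change beta 𝔽 p μ ν (Subtype.val ⁻¹' (upperLeft 𝔽 h ⁻¹' t)) = _
  rw [beta_preimage_val hμp hνp ht', beta_preimage_val hμq hνq ht, hmass]
  have := hint (t.indicator 1) (measurable_one.indicator ht)
  change ∫⁻ x, (upperLeft 𝔽 h ⁻¹' t).indicator 1 x * _ ∂_ = _ at this
  rw [this, ENNReal.mul_inv (.inl hC) (.inl hC'), mul_mul_mul_comm, ENNReal.inv_mul_cancel hC hC',
    one_mul]

/-- Explains both numerical conditions: μ - n/q > -1 means μ > d(q-1)/2, and n(p)/p - n(q)/q =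
d(p-q)/2. -/
theorem hermDim_div {q : ℕ} (hq : 1 ≤ q) :
    hermDim 𝔽 q / q = 1 + realDim 𝔽 / 2 * ((q : ℝ) - 1) := by
  have : (q : ℝ) ≠ 0 := Nat.cast_ne_zero.2 (by omega)
  rw [hermDim]
  field_simp

theorem beta_projection (hq : 1 ≤ q) (h : q ≤ p) {μ ν : ℝ}
    (hμ : (realDim 𝔽 : ℝ) * (p - 1) / 2 < μ) (hν : (realDim 𝔽 : ℝ) * (p - 1) / 2 < ν) :
    IsProbabilityMeasure (beta 𝔽 p μ ν) ∧ IsProbabilityMeasure (beta 𝔽 q μ ν) ∧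
      Measurable (proj 𝔽 h) ∧ Measure.map (proj 𝔽 h) (beta 𝔽 p μ ν) = beta 𝔽 q μ ν := by
  have hp := hermDim_div (𝔽 := 𝔽) (hq.trans h)
  have hq := hermDim_div (𝔽 := 𝔽) hq
  have hd : (0 : ℝ) ≤ realDim 𝔽 / 2 := by positivity
  have hqp : (realDim 𝔽 : ℝ) / 2 * (q - 1) ≤ realDim 𝔽 / 2 * (p - 1) := by gcongr
  have hμp : -1 < μ - hermDim 𝔽 p / p := by rw [hp]; linarith
  have hνp : -1 < ν - hermDim 𝔽 p / p := by rw [hp]; linarith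
  have hμq : -1 < μ - hermDim 𝔽 q / q := by rw [hq]; linarith
  have hνq : -1 < ν - hermDim 𝔽 q / q := by rw [hq]; linarith
  exact ⟨isProbabilityMeasure_beta hμp hνp, isProbabilityMeasure_beta hμq hνq, measurable_proj h,
    map_proj_beta h hμp hνp hμq hνq (by rw [hp, hq]; ring)⟩

end Beta

/-! ### The three scalar fields. -/

instance : IsRealHermitian ℝ where
  exists_algebraMap_eq a _ := ⟨a, rfl⟩
  exists_star_mul_self a := ⟨a * a, mul_self_nonneg a, rfl⟩

instance : IsRealHermitian ℂ where
  exists_algebraMap_eq a h := ⟨a.re, Complex.conj_eq_iff_re.1 h⟩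
  exists_star_mul_self a := ⟨Complex.normSq a, Complex.normSq_nonneg a,
    (Complex.normSq_eq_conj_mul_self).symm⟩

instance : IsRealHermitian ℍ[ℝ] where
  exists_algebraMap_eq a h := ⟨a.re, (Quaternion.star_eq_self.1 h).symm⟩
  exists_star_mul_self a := ⟨Quaternion.normSq a, Quaternion.normSq_nonneg,
    Quaternion.star_mul_self a⟩

end MatrixBeta

end

theorem proposition6p6 (p q : ℕ) (hq : 1 ≤ q) (hqp : q ≤ p) (μ ν : ℝ) :
    ((1 : ℝ) * ((p : ℝ) - 1) / 2 < μ → (1 : ℝ) * ((p : ℝ) - 1) / 2 < ν →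
      IsProbabilityMeasure (MatrixBeta.beta ℝ p μ ν) ∧
      IsProbabilityMeasure (MatrixBeta.beta ℝ q μ ν) ∧
      Measurable (MatrixBeta.proj ℝ hqp) ∧
      Measure.map (MatrixBeta.proj ℝ hqp) (MatrixBeta.beta ℝ p μ ν) = MatrixBeta.beta ℝ q μ ν) ∧
    ((2 : ℝ) * ((p : ℝ) - 1) / 2 < μ → (2 : ℝ) * ((p : ℝ) - 1) / 2 < ν →
      IsProbabilityMeasure (MatrixBeta.beta ℂ p μ ν) ∧
      IsProbabilityMeasure (MatrixBeta.beta ℂ q μ ν) ∧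
      Measurable (MatrixBeta.proj ℂ hqp) ∧
      Measure.map (MatrixBeta.proj ℂ hqp) (MatrixBeta.beta ℂ p μ ν) = MatrixBeta.beta ℂ q μ ν) ∧
    ((4 : ℝ) * ((p : ℝ) - 1) / 2 < μ → (4 : ℝ) * ((p : ℝ) - 1) / 2 < ν →
      IsProbabilityMeasure (MatrixBeta.beta ℍ[ℝ] p μ ν) ∧
      IsProbabilityMeasure (MatrixBeta.beta ℍ[ℝ] q μ ν) ∧
      Measurable (MatrixBeta.proj ℍ[ℝ] hqp) ∧
      Measure.map (MatrixBeta.proj ℍ[ℝ] hqp) (MatrixBeta.beta ℍ[ℝ] p μ ν) =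
        MatrixBeta.beta ℍ[ℝ] q μ ν) := by
  have hR : MatrixBeta.realDim ℝ = 1 := Module.finrank_self ℝ
  have hC : MatrixBeta.realDim ℂ = 2 := Complex.finrank_real_complex
  have hH : MatrixBeta.realDim ℍ[ℝ] = 4 := Quaternion.finrank_eq_four
  -- Supplies the local compactness of the quaternions that `MatrixBeta.beta_projection` requires.
  have : ProperSpace ℍ[ℝ] := FiniteDimensional.proper_real ℍ[ℝ]
  refine ⟨fun hμ hν => ?_, fun hμ hν => ?_, fun hμ hν => ?_⟩
  · exact MatrixBeta.beta_projection hq hqp (by rw [hR]; exact_mod_cast hμ)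
      (by rw [hR]; exact_mod_cast hν)
  · exact MatrixBeta.beta_projection hq hqp (by rw [hC]; exact_mod_cast hμ)
      (by rw [hC]; exact_mod_cast hν)
  · exact MatrixBeta.beta_projection hq hqp (by rw [hH]; exact_mod_cast hμ)
      (by rw [hH]; exact_mod_cast hν)
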